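/- Let $I=[0,1)$, let $\alpha,\beta\in(0,1)$ with $\alpha+\beta<1$, and put $\lambda_n=n^{1-(\alpha+\beta)}$, $n\ge 1$. Let $f:I^2\to\mathbb R$ be a Lebesgue measurable function in the Dyachenko–Waterman class $\{n^{1-(\alpha+\beta)}\}^{*}BV$, that is, $$\sup_{y\in I}\sup_{\{(a_i,b_i)\}}\sum_i\frac{|f(b_i,y)-f(a_i,y)|}{\lambda_i}+\sup_{x\in I}\sup_{\{(c_j,d_j)\}}\sum_j\frac{|f(x,d_j)-f(x,c_j)|}{\lambda_j}+\sup_{\{A_k\}}\sum_k\frac{|f(A_k)|}{\lambda_k}<\infty,$$ where the inner suprema in the first two terms run over all finite collections, in arbitrary order, of nonoverlapping intervals with end points in $I$, the last supremum runs over all finite collections, in arbitrary order, of nonoverlapping rectangles $A_k=[a_k,b_k]\times[c_k,d_k]\subset I^2$, and $f(A_k)=f(a_k,c_k)-f(a_k,d_k)-f(b_k,c_k)+f(b_k,d_k)$. Let $w_0,w_1,\dots$ be the Walsh functions in the Paley ordering: $w_k=\prod_{j:\,k_j=1}r_j$ for $k=\sum_j k_j2^j$, $k_j\in\{0,1\}$,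 where $r_j(x)=r_0(2^jx)$ and $r_0$ is the $1$-periodic function equal to $1$ on $[0,1/2)$ and to $-1$ on $[1/2,1)$. Let $\hat f(m,n)=\int_{I^2}f(s,t)w_m(s)w_n(t)\,ds\,dt$, $S_{M,N}(x,y;f)=\sum_{m=0}^{M-1}\sum_{n=0}^{N-1}\hat f(m,n)w_m(x)w_n(y)$, $A^{\gamma}_0=1$, $A_k^{\gamma}=\frac{(\gamma+1)\cdots(\gamma+k)}{k!}$, and for $n,m\ge1$ let $$\sigma_{n,m}^{-\alpha,-\beta}(x,y;f)=\frac{1}{A_{n-1}^{-\alpha}A_{m-1}^{-\beta}}\sum_{i=1}^{n}\sum_{j=1}^{m}A_{n-i}^{-\alpha-1}A_{m-j}^{-\beta-1}S_{i,j}(x,y;f).$$ Then $\sigma_{n,m}^{-\alpha,-\beta}(x,y;f)\to f(x,y)$ as $n,m\to\infty$ independently of each other (convergence in the sense of Pringsheim), at every point $(x,y)\in I^2$ at which $f$ is continuous in the dyadic sense, that is, $f(x\dotplus h,y\dotplus\delta)\to f(x,y)$ as $h,\delta\to0$ in $I$. Here $x\dotplus h=\sum_{k\ge0}|x_k-h_k|2^{-(k+1)}$,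 where $x=\sum_{k\ge 0} x_k2^{-(k+1)}$ and $h=\sum_{k\ge 0} h_k2^{-(k+1)}$ with $x_k,h_k\in\{0,1\}$ are the dyadic expansions (the ones ending in zeros for dyadic rationals). -/

import Mathlib

open Filter Topology MeasureTheory
open scoped ENNReal

namespace DoubleWalsh

noncomputable section

/-- The interval `I = [0, 1)`. -/
def I : Set ℝ := Set.Ico 0 1

/-- The unit square `I² = [0, 1) × [0, 1)`. -/
def I2 : Set (ℝ × ℝ) := I ×ˢ I

/-! ### Generalized variation -/

/-- `f(Δ, J) = f(a, c) - f(a, d) - f(b, c) + f(b, d)` for `Δ = (a, b)`, `J = (c, d)`. -/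
def rectDiff (f : ℝ × ℝ → ℝ) (a b c d : ℝ) : ℝ :=
  f (a, c) - f (a, d) - f (b, c) + f (b, d)

/-- `(a i, b i)`, `i < n`, is a finite ordered collection of nonoverlapping intervals
with end points in `I`. -/
def IsIntervalFamily {n : ℕ} (a b : Fin n → ℝ) : Prop :=
  (∀ i, a i ∈ I ∧ b i ∈ I ∧ a i < b i) ∧
    Pairwise fun i j => Disjoint (Set.Ioo (a i) (b i)) (Set.Ioo (a j) (b j))

/-- `[a k, b k] × [c k, d k]`, `k < n`, is a finite ordered collection of rectangles in `I²`
with pairwise disjoint interiors. -/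
def IsRectFamily {n : ℕ} (a b c d : Fin n → ℝ) : Prop :=
  (∀ k, a k ∈ I ∧ b k ∈ I ∧ c k ∈ I ∧ d k ∈ I ∧ a k < b k ∧ c k < d k) ∧
    Pairwise fun k l => Disjoint (Set.Ioo (a k) (b k) ×ˢ Set.Ioo (c k) (d k))
      (Set.Ioo (a l) (b l) ×ˢ Set.Ioo (c l) (d l))

/-- `Λ V₁(f)`, where `Λ = (L 1, L 2, …)`. The terms are nonnegative, so that finite collections
of intervals give the same supremum as countable ones. -/
def V1 (L : ℕ → ℝ) (f : ℝ × ℝ → ℝ) : ℝ≥0∞ :=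
  ⨆ (y : ℝ) (_ : y ∈ I) (n : ℕ) (a : Fin n → ℝ) (b : Fin n → ℝ) (_ : IsIntervalFamily a b),
    ENNReal.ofReal (∑ i : Fin n, |f (b i, y) - f (a i, y)| / L (i + 1))

/-- `Λ V₂(f)`, where `Λ = (L 1, L 2, …)`. -/
def V2 (L : ℕ → ℝ) (f : ℝ × ℝ → ℝ) : ℝ≥0∞ :=
  ⨆ (x : ℝ) (_ : x ∈ I) (n : ℕ) (c : Fin n → ℝ) (d : Fin n → ℝ) (_ : IsIntervalFamily c d),
    ENNReal.ofReal (∑ j : Fin n, |f (x, d j) - f (x, c j)| / L (j + 1))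

/-- `Λ^* V(f)`, where `Λ = (L 1, L 2, …)`. -/
def VStar (L : ℕ → ℝ) (f : ℝ × ℝ → ℝ) : ℝ≥0∞ :=
  ⨆ (n : ℕ) (a : Fin n → ℝ) (b : Fin n → ℝ) (c : Fin n → ℝ) (d : Fin n → ℝ)
    (_ : IsRectFamily a b c d),
    ENNReal.ofReal (∑ k : Fin n, |rectDiff f (a k) (b k) (c k) (d k)| / L (k + 1))

/-- The Dyachenko–Waterman class `Λ^* BV` of (Lebesgue) measurable functions on `I²`. -/
def StarBV (L : ℕ → ℝ) : Set (ℝ × ℝ → ℝ) :=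
  {f | AEMeasurable f (volume.restrict I2) ∧ V1 L f + V2 L f + VStar L f < ∞}

/-! ### Dyadic addition and dyadic continuity -/

/-- The digit `x_k` of the dyadic expansion `x = ∑ x_k 2^{-(k+1)}` of `x ∈ I`; for a dyadic
rational this is the expansion that ends in zeros. -/
def digit (x : ℝ) (k : ℕ) : ℕ := ⌊2 ^ (k + 1) * x⌋₊ % 2

/-- The dyadic sum of two points of `I`. -/
def dyadicAdd (x y : ℝ) : ℝ :=
  ∑' k : ℕ, |(digit x k : ℝ) - (digit y k : ℝ)| / 2 ^ (k + 1)

/-- `f` is continuous at `(x, y)`: `f(x ∔ h, y ∔ δ) → f(x, y)` as `h, δ → 0` in `I`. -/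
def DyadicContinuousAt (f : ℝ × ℝ → ℝ) (x y : ℝ) : Prop :=
  Tendsto (fun h : ℝ × ℝ => f (dyadicAdd x h.1, dyadicAdd y h.2)) (𝓝[I2] (0, 0)) (𝓝 (f (x, y)))

/-! ### Walsh functions, Walsh–Fourier series, Cesàro means -/

/-- The `1`-periodic function `r₀`. -/
def rademacherZero (x : ℝ) : ℝ := if Int.fract x < 1 / 2 then 1 else -1

/-- The Rademacher functions. -/
def rademacher (n : ℕ) (x : ℝ) : ℝ := rademacherZero (2 ^ n * x)

/-- The Walsh functions: the product of the `r_j` over the binary digits `1` of `k`. -/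
def walsh (k : ℕ) (x : ℝ) : ℝ :=
  ∏ j ∈ (Finset.range k).filter (fun j => k.testBit j = true), rademacher j x

/-- The double Walsh–Fourier coefficients. -/
def coeff (f : ℝ × ℝ → ℝ) (n m : ℕ) : ℝ :=
  ∫ p in I2, f p * walsh n p.1 * walsh m p.2

/-- The rectangular partial sums `S_{M,N}(x, y; f)`. -/
def partialSum (f : ℝ × ℝ → ℝ) (M N : ℕ) (x y : ℝ) : ℝ :=
  ∑ m ∈ Finset.range M, ∑ n ∈ Finset.range N, coeff f m n * walsh m x * walsh n y

/-- The Cesàro numbers `A_n^α = (α + 1) ⋯ (α + n) / n!`. -/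
def cesaroA (α : ℝ) (n : ℕ) : ℝ :=
  (∏ k ∈ Finset.range n, (α + (k + 1))) / (n.factorial : ℝ)

/-- The `(C; α, β)` means `σ_{n,m}^{α,β}(x, y; f)` (meaningful for `n, m ≥ 1`). -/
def cesaroMean (α β : ℝ) (f : ℝ × ℝ → ℝ) (n m : ℕ) (x y : ℝ) : ℝ :=
  (1 / (cesaroA α (n - 1) * cesaroA β (m - 1))) *
    ∑ i ∈ Finset.Icc 1 n, ∑ j ∈ Finset.Icc 1 m,
      cesaroA (α - 1) (n - i) * cesaroA (β - 1) (m - j) * partialSum f i j x y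

end

end DoubleWalsh

/-! Put p = log₂ n. In each variable the Cesàro kernel of order -α is compared with the
Walsh–Dirichlet kernel of order 2^p, which is 2^p times the indicator of the dyadic interval of
length 2^{-p} at x. The difference is cut twice: by frequency into the blocks [2^q, 2^{q+1}), q = p
- i, and in space into shells, shell d ≥ 1 consisting of the points that separate from x at level q
- d and shell 0 being the dyadic interval of length 2^{-q} at x.

The piece (i, d) has three properties. Its size is at most a constant times 2^{-i} 2^q 2^{-d(1-α)}:
the coefficients in a block are increasing and controlled by a negative power of the distance to its
end (`excess_block_le`), while the partial sums of the Dirichlet kernel are at most 2^{q-d+1} on the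
shell, so that summation by parts applies (`abs_sum_mul_le_of_rpow_bound`). It is odd with respect
to the halves of each dyadic interval of length 2^{-q}, because every frequency of the block
contains r_q. It lives on at most 2^d of these intervals.

By oddness, the integral of f against a product of two pieces is an average, over translates of a
grid, of weighted sums of mixed differences of f over at most 2^{d+d'} disjoint rectangles. As λ is
increasing, the sum of the absolute values of N such differences is at most λ_N V. Together with the
sizes of the pieces this leaves a constant times 2^{-i-βd} 2^{-i'-αd'}, which is summable and
independent of n and m. A piece times a Dirichlet kernel is treated in the same way, by the
variation in one variable.

With the indices of the pieces fixed and n, m → ∞, the kernels shrink to the point with bounded L¹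
norms. Pieces have integral zero and Dirichlet kernels have integral one, so dyadic continuity gives
the limit 0 for each term except the product of the Dirichlet kernels, whose limit is f(x, y)
(`Concentrates.tendsto_integral`). Dominated convergence for series
(`tendsto_sum_zero_of_dominated`) then sums the terms. -/

namespace DoubleWalsh

/-! ### Dyadic cells and Walsh functions -/

/-- The index of the dyadic interval of length `2⁻ᵠ` that contains `s`. -/
noncomputable def cell (q : ℕ) (s : ℝ) : ℕ := ⌊2 ^ q * s⌋₊

lemma cell_add_div (q d : ℕ) (s : ℝ) : cell (q + d) s / 2 ^ d = cell q s := by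
  unfold cell
  have h := Nat.floor_div_natCast ((2 : ℝ) ^ (q + d) * s) (2 ^ d)
  rw [← h]
  congr 1
  push_cast
  rw [pow_add]
  field_simp

lemma cell_sub_div {q d : ℕ} (h : d ≤ q) (s : ℝ) : cell q s / 2 ^ d = cell (q - d) s := by
  have := cell_add_div (q - d) d s
  rwa [Nat.sub_add_cancel h] at this

lemma cell_lt {s : ℝ} (hs : s ∈ I) (q : ℕ) : cell q s < 2 ^ q := by
  unfold cell
  have h0 : (0 : ℝ) < 2 ^ q := by positivity
  rw [Nat.floor_lt (mul_nonneg h0.le hs.1)]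
  push_cast
  nlinarith [hs.2]

lemma cell_zero {s : ℝ} (hs : s ∈ I) : cell 0 s = 0 := by
  have := cell_lt hs 0
  simpa using this

lemma cell_eq_iff {s : ℝ} (hs : 0 ≤ s) (q e : ℕ) :
    cell q s = e ↔ s ∈ Set.Ico ((e : ℝ) / 2 ^ q) ((e + 1 : ℝ) / 2 ^ q) := by
  have h0 : (0 : ℝ) < 2 ^ q := by positivity
  unfold cell
  rw [Nat.floor_eq_iff (by positivity), Set.mem_Ico, div_le_iff₀ h0, lt_div_iff₀ h0,
    mul_comm s]

lemma cell_tile (q e : ℕ) {τ : ℝ} (hτ : τ ∈ Set.Ico (0 : ℝ) (1 / 2 ^ q)) :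
    cell q (e / 2 ^ q + τ) = e := by
  have h0 : (0 : ℝ) < 2 ^ q := by positivity
  rw [cell_eq_iff (by have := hτ.1; positivity)]
  constructor
  · linarith [hτ.1]
  · rw [add_div]
    linarith [hτ.2]

lemma cell_mono_eq {s x : ℝ} {j q : ℕ} (hjq : j ≤ q) (h : cell q s = cell q x) :
    cell j s = cell j x := by
  have h1 := cell_sub_div (Nat.sub_le q j) s
  have h2 := cell_sub_div (Nat.sub_le q j) x
  rw [Nat.sub_sub_self hjq] at h1 h2
  rw [← h1, ← h2, h]

lemma measurable_cell (q : ℕ) : Measurable (cell q) :=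
  Nat.measurable_floor.comp (measurable_const_mul _)

lemma rademacher_eq {s : ℝ} (hs : 0 ≤ s) (j : ℕ) :
    rademacher j s = if digit s j = 0 then 1 else -1 := by
  unfold rademacher rademacherZero digit
  have hy : 0 ≤ 2 ^ j * s := by positivity
  set y := 2 ^ j * s with hyd
  have e : (2 : ℝ) ^ (j + 1) * s = 2 * y := by rw [hyd, pow_succ]; ring
  have hf : Int.fract y = y - ⌊y⌋₊ := by
    rw [Int.fract, natCast_floor_eq_intCast_floor hy]
  have h1 := Nat.floor_le hy
  have h2 := Nat.lt_floor_add_one y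
  rw [e, hf]
  by_cases h : y - ⌊y⌋₊ < 1 / 2
  · have : ⌊2 * y⌋₊ = 2 * ⌊y⌋₊ := by
      rw [Nat.floor_eq_iff (by positivity)]
      push_cast
      constructor <;> linarith
    rw [if_pos h, this, if_pos (by omega)]
  · have : ⌊2 * y⌋₊ = 2 * ⌊y⌋₊ + 1 := by
      rw [Nat.floor_eq_iff (by positivity)]
      push_cast
      constructor <;> linarith
    rw [if_neg h, this, if_neg (by omega)]

lemma digit_eq_cell (s : ℝ) (j : ℕ) : digit s j = cell (j + 1) s % 2 := rfl

lemma abs_rademacher (j : ℕ) (s : ℝ) : |rademacher j s| = 1 := by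
  unfold rademacher rademacherZero
  split_ifs <;> simp

lemma abs_walsh (k : ℕ) (s : ℝ) : |walsh k s| = 1 := by
  unfold walsh
  rw [Finset.abs_prod]
  exact Finset.prod_eq_one fun j _ => abs_rademacher j s

lemma measurable_rademacher (j : ℕ) : Measurable (rademacher j) := by
  unfold rademacher rademacherZero
  exact Measurable.ite (measurableSet_lt (measurable_fract.comp (measurable_const_mul _))
    measurable_const) measurable_const measurable_const

lemma measurable_walsh (k : ℕ) : Measurable (walsh k) := by
  unfold walsh
  exact Finset.measurable_prod _ fun j _ => measurable_rademacher j

/-- Provides a common range of digits, so that Walsh functions of different indices can be compared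
factor by factor. -/
lemma walsh_eq_prod {k Q : ℕ} (h : k < 2 ^ Q) (s : ℝ) :
    walsh k s = ∏ j ∈ Finset.range Q, if k.testBit j = true then rademacher j s else 1 := by
  unfold walsh
  rw [← Finset.prod_filter]
  refine Finset.prod_congr ?_ fun _ _ => rfl
  ext j
  simp only [Finset.mem_filter, Finset.mem_range]
  constructor
  · rintro ⟨_, hj⟩
    have := Nat.ge_two_pow_of_testBit hj
    exact ⟨(Nat.pow_lt_pow_iff_right (by norm_num : 1 < 2)).1 (this.trans_lt h), hj⟩
  · rintro ⟨_, hj⟩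
    exact ⟨Nat.lt_two_pow_self.trans_le (Nat.ge_two_pow_of_testBit hj), hj⟩

/-- No carries occur: the binary digits of the sum are those of the two summands side by side. -/
lemma walsh_two_pow_mul_add (J l : ℕ) {r : ℕ} (hr : r < 2 ^ J) (s : ℝ) :
    walsh (2 ^ J * l + r) s = walsh (2 ^ J * l) s * walsh r s := by
  have hQ := Nat.lt_two_pow_self (n := 2 ^ J * l + r)
  rw [walsh_eq_prod hQ, walsh_eq_prod (k := 2 ^ J * l) ((Nat.le_add_right _ r).trans_lt hQ),
    walsh_eq_prod (k := r) ((Nat.le_add_left r _).trans_lt hQ), ← Finset.prod_mul_distrib]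
  refine Finset.prod_congr rfl fun j _ => ?_
  rw [Nat.testBit_two_pow_mul_add _ hr, Nat.testBit_two_pow_mul]
  by_cases hj : j < J
  · simp [hj, not_le.2 hj]
  · have : r.testBit j = false :=
      Nat.testBit_lt_two_pow (hr.trans_le (Nat.pow_le_pow_right (by norm_num) (not_lt.1 hj)))
    simp [hj, this, not_lt.1 hj]

lemma walsh_two_pow (q : ℕ) (s : ℝ) : walsh (2 ^ q) s = rademacher q s := by
  rw [walsh_eq_prod (Q := q + 1) (Nat.pow_lt_pow_right (by norm_num) (by omega)),
    Finset.prod_range_succ, Finset.prod_eq_one]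
  · simp
  · intro j hj
    rw [Finset.mem_range] at hj
    simp [hj.ne']

lemma walsh_two_pow_add {q r : ℕ} (hr : r < 2 ^ q) (s : ℝ) :
    walsh (2 ^ q + r) s = rademacher q s * walsh r s := by
  have := walsh_two_pow_mul_add q 1 hr s
  rwa [mul_one, walsh_two_pow] at this

lemma digit_congr {s t : ℝ} {q j : ℕ} (hj : j < q) (h : cell q s = cell q t) :
    digit s j = digit t j := by
  rw [digit_eq_cell, digit_eq_cell, cell_mono_eq hj h]

lemma rademacher_congr {s t : ℝ} (hs : 0 ≤ s) (ht : 0 ≤ t) {q j : ℕ} (hj : j < q)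
    (h : cell q s = cell q t) : rademacher j s = rademacher j t := by
  rw [rademacher_eq hs, rademacher_eq ht, digit_congr hj h]

lemma walsh_congr {s t : ℝ} (hs : 0 ≤ s) (ht : 0 ≤ t) {q k : ℕ} (hk : k < 2 ^ q)
    (h : cell q s = cell q t) : walsh k s = walsh k t := by
  rw [walsh_eq_prod hk, walsh_eq_prod hk]
  refine Finset.prod_congr rfl fun j hj => ?_
  rw [rademacher_congr hs ht (Finset.mem_range.1 hj) h]

/-! ### The Walsh–Dirichlet kernel -/

/-- The terms `w_k(x) w_k(s)` of the Dirichlet kernel. -/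
noncomputable def walshPair (x s : ℝ) (k : ℕ) : ℝ := walsh k x * walsh k s

lemma abs_walshPair (x s : ℝ) (k : ℕ) : |walshPair x s k| = 1 := by
  simp [walshPair, abs_mul, abs_walsh]

lemma walshPair_two_pow_mul_add (x s : ℝ) (J l : ℕ) {r : ℕ} (hr : r < 2 ^ J) :
    walshPair x s (2 ^ J * l + r) = walshPair x s (2 ^ J * l) * walshPair x s r := by
  simp only [walshPair, walsh_two_pow_mul_add J l hr]
  ring

lemma walshPair_eq_one {x s : ℝ} (hx : 0 ≤ x) (hs : 0 ≤ s) {q k : ℕ} (hk : k < 2 ^ q)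
    (h : cell q s = cell q x) : walshPair x s k = 1 := by
  have h1 := abs_walsh k x
  rw [walshPair, walsh_congr hs hx hk h, ← abs_mul_abs_self, h1, one_mul]

lemma rademacher_mul_eq_neg_one {x s : ℝ} (hx : 0 ≤ x) (hs : 0 ≤ s) {j : ℕ}
    (h : cell j s = cell j x) (h' : cell (j + 1) s ≠ cell (j + 1) x) :
    rademacher j x * rademacher j s = -1 := by
  rw [rademacher_eq hx, rademacher_eq hs, digit_eq_cell, digit_eq_cell]
  have h1 := cell_add_div j 1 s
  have h2 := cell_add_div j 1 x
  rw [pow_one] at h1 h2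
  have h3 := Nat.mod_two_eq_zero_or_one (cell (j + 1) s)
  have h4 := Nat.mod_two_eq_zero_or_one (cell (j + 1) x)
  rcases h3 with h3 | h3 <;> rcases h4 with h4 | h4
  · omega
  · simp [h3, h4]
  · simp [h3, h4]
  · omega

/-- The terms k and 2^j + k cancel: they differ by the factor r_j(x) r_j(s), which is -1 at the
level where the points separate. -/
lemma sum_walshPair_two_pow {x s : ℝ} (hx : 0 ≤ x) (hs : 0 ≤ s) {j : ℕ}
    (h : cell j s = cell j x) (h' : cell (j + 1) s ≠ cell (j + 1) x) :
    ∑ k ∈ Finset.range (2 ^ (j + 1)), walshPair x s k = 0 := by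
  rw [pow_succ, mul_two, Finset.sum_range_add, ← Finset.sum_add_distrib]
  refine Finset.sum_eq_zero fun k hk => ?_
  have h1 := walshPair_two_pow_mul_add x s j 1 (Finset.mem_range.1 hk)
  rw [mul_one] at h1
  rw [h1]
  have h2 : walshPair x s (2 ^ j) = -1 := by
    rw [walshPair, walsh_two_pow, walsh_two_pow, rademacher_mul_eq_neg_one hx hs h h']
  rw [h2]
  ring

lemma sum_walshPair_two_pow_mul {x s : ℝ} (hx : 0 ≤ x) (hs : 0 ≤ s) {j : ℕ}
    (h : cell j s = cell j x) (h' : cell (j + 1) s ≠ cell (j + 1) x) (l : ℕ) :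
    ∑ k ∈ Finset.range (2 ^ (j + 1) * l), walshPair x s k = 0 := by
  induction l with
  | zero => simp
  | succ l ih =>
    rw [mul_add, mul_one, Finset.sum_range_add, ih, zero_add]
    rw [Finset.sum_congr rfl fun k hk =>
      walshPair_two_pow_mul_add x s (j + 1) l (Finset.mem_range.1 hk), ← Finset.mul_sum,
      sum_walshPair_two_pow hx hs h h', mul_zero]

lemma abs_sum_walshPair_le (x s : ℝ) (A : Finset ℕ) :
    |∑ k ∈ A, walshPair x s k| ≤ A.card := by
  refine (Finset.abs_sum_le_sum_abs _ _).trans ?_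
  simp [abs_walshPair]

/-- Complete blocks of length 2^{j+1} sum to zero; what remains is a shorter sum of terms of modulus
one. -/
lemma abs_sum_range_walshPair_le {x s : ℝ} (hx : 0 ≤ x) (hs : 0 ≤ s) {j : ℕ}
    (h : cell j s = cell j x) (h' : cell (j + 1) s ≠ cell (j + 1) x) (K : ℕ) :
    |∑ k ∈ Finset.range K, walshPair x s k| ≤ 2 ^ (j + 1) := by
  rw [← Nat.div_add_mod K (2 ^ (j + 1)), Finset.sum_range_add,
    sum_walshPair_two_pow_mul hx hs h h', zero_add]
  refine (Finset.abs_sum_le_sum_abs _ _).trans ?_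
  simp only [abs_walshPair, Finset.sum_const, Finset.card_range, nsmul_eq_mul, mul_one]
  exact_mod_cast (Nat.mod_lt _ (by positivity)).le

/-- Two points in different cells of level `q` separate at a unique level below `q`. -/
lemma exists_separating_level {x s : ℝ} (hx : x ∈ I) (hs : s ∈ I) {q : ℕ}
    (h : cell q s ≠ cell q x) :
    ∃ j < q, cell j s = cell j x ∧ cell (j + 1) s ≠ cell (j + 1) x := by
  induction q with
  | zero => exact absurd ((cell_zero hs).trans (cell_zero hx).symm) h
  | succ q ih =>
    by_cases hq : cell q s = cell q x
    · exact ⟨q, Nat.lt_succ_self q, hq, h⟩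
    · obtain ⟨j, hj, h1⟩ := ih hq
      exact ⟨j, hj.trans (Nat.lt_succ_self q), h1⟩

lemma dirichlet_two_pow {x s : ℝ} (hx : x ∈ I) (hs : s ∈ I) (q : ℕ) :
    ∑ k ∈ Finset.range (2 ^ q), walshPair x s k = if cell q s = cell q x then 2 ^ q else 0 := by
  split_ifs with h
  · rw [Finset.sum_congr rfl fun k hk =>
      walshPair_eq_one hx.1 hs.1 (Finset.mem_range.1 hk) h]
    simp
  · obtain ⟨j, hj, h1, h2⟩ := exists_separating_level hx hs h
    obtain ⟨m, rfl⟩ := Nat.exists_eq_add_of_le (Nat.succ_le_of_lt hj)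
    rw [Nat.succ_eq_add_one, pow_add]
    exact sum_walshPair_two_pow_mul hx.1 hs.1 h1 h2 _

/-! ### Cesàro numbers of negative order -/

lemma cesaroA_zero (γ : ℝ) : cesaroA γ 0 = 1 := by simp [cesaroA]

lemma cesaroA_succ (γ : ℝ) (n : ℕ) :
    cesaroA γ (n + 1) = cesaroA γ n * ((γ + (n + 1)) / (n + 1)) := by
  unfold cesaroA
  rw [Finset.prod_range_succ, Nat.factorial_succ]
  push_cast
  have : (n.factorial : ℝ) ≠ 0 := by positivity
  field_simp

lemma cesaroA_sub_one_mul (γ : ℝ) (n : ℕ) :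
    cesaroA (γ - 1) (n + 1) * (n + 1) = γ * cesaroA γ n := by
  induction n with
  | zero => rw [cesaroA_succ]; simp [cesaroA_zero]
  | succ n ih =>
    rw [cesaroA_succ, cesaroA_succ γ]
    have h : (n : ℝ) + 1 ≠ 0 := by positivity
    have h' : (n : ℝ) + 1 + 1 ≠ 0 := by positivity
    have e : cesaroA (γ - 1) (n + 1) = γ * cesaroA γ n / (n + 1) := by
      rw [← ih]; field_simp
    rw [e]
    push_cast
    field_simp
    ring

lemma sum_cesaroA_sub_one (γ : ℝ) (n : ℕ) :
    ∑ i ∈ Finset.range (n + 1), cesaroA (γ - 1) i = cesaroA γ n := by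
  induction n with
  | zero => simp [cesaroA_zero]
  | succ n ih =>
    rw [Finset.sum_range_succ, ih, cesaroA_succ γ]
    have h : (n : ℝ) + 1 ≠ 0 := by positivity
    have := cesaroA_sub_one_mul γ n
    have e : cesaroA (γ - 1) (n + 1) = γ * cesaroA γ n / (n + 1) := by
      rw [← this]; field_simp
    rw [e]
    field_simp
    ring

lemma cesaroA_neg_pos {α : ℝ} (hα : α ∈ Set.Ioo (0 : ℝ) 1) (n : ℕ) : 0 < cesaroA (-α) n := by
  unfold cesaroA
  refine div_pos (Finset.prod_pos fun k _ => ?_) (by positivity)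
  have := hα.2
  have : (0 : ℝ) ≤ k := by positivity
  linarith

lemma cesaroA_neg_sub_succ (α : ℝ) (n : ℕ) :
    cesaroA (-α) n - cesaroA (-α) (n + 1) = cesaroA (-α) n * (α / (n + 1)) := by
  rw [cesaroA_succ]
  field_simp
  ring

lemma cesaroA_neg_antitone {α : ℝ} (hα : α ∈ Set.Ioo (0 : ℝ) 1) : Antitone (cesaroA (-α)) := by
  refine antitone_nat_of_succ_le fun n => ?_
  have h := cesaroA_neg_sub_succ α n
  have : 0 ≤ cesaroA (-α) n * (α / (n + 1)) :=
    mul_nonneg (cesaroA_neg_pos hα n).le (div_nonneg hα.1.le (by positivity))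
  linarith

/-- Induction with Bernoulli's inequality: the ratio 1 - α/(n+1) of consecutive numbers times
((n+2)/(n+1))^α ≤ 1 + α/(n+1) is at most 1. -/
lemma cesaroA_neg_le {α : ℝ} (hα : α ∈ Set.Ioo (0 : ℝ) 1) (n : ℕ) : cesaroA (-α) n ≤ ((n : ℝ) + 1) ^ (-α) := by
  induction n with
  | zero => simp [cesaroA_zero]
  | succ n ih =>
    rw [cesaroA_succ]
    have hn : (0 : ℝ) < n + 1 := by positivity
    have hn' : (0 : ℝ) < n + 1 + 1 := by positivity
    have hb : (1 + 1 / ((n : ℝ) + 1)) ^ α ≤ 1 + α * (1 / (n + 1)) :=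
      rpow_one_add_le_one_add_mul_self (by
        have : 0 ≤ 1 / ((n : ℝ) + 1) := by positivity
        linarith) hα.1.le hα.2.le
    have he : ((n : ℝ) + 1 + 1) ^ (-α) = (n + 1 : ℝ) ^ (-α) / (1 + 1 / ((n : ℝ) + 1)) ^ α := by
      have : (n : ℝ) + 1 + 1 = (n + 1) * (1 + 1 / (n + 1)) := by field_simp
      rw [this, Real.mul_rpow hn.le (by positivity),
        Real.rpow_neg (by positivity : (0 : ℝ) ≤ 1 + 1 / (n + 1))]
      rfl
    push_cast
    rw [he]
    have hp : 0 < (1 + 1 / ((n : ℝ) + 1)) ^ α := Real.rpow_pos_of_pos (by positivity) _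
    have hq : 0 < (n + 1 : ℝ) ^ (-α) := Real.rpow_pos_of_pos hn _
    have hr : 0 ≤ (-α + (n + 1)) / ((n : ℝ) + 1) :=
      div_nonneg (by have := hα.2; have : (0 : ℝ) ≤ n := by positivity
                     linarith) hn.le
    rw [le_div_iff₀ hp]
    calc cesaroA (-α) n * ((-α + (n + 1)) / (n + 1)) * (1 + 1 / ((n : ℝ) + 1)) ^ α
        ≤ (n + 1 : ℝ) ^ (-α) * ((-α + (n + 1)) / (n + 1)) * (1 + α * (1 / (n + 1))) := by
          gcongr
      _ = (n + 1 : ℝ) ^ (-α) * (1 - (α / (n + 1)) ^ 2) := by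
          field_simp
          ring
      _ ≤ (n + 1 : ℝ) ^ (-α) * 1 := by
          gcongr
          have := sq_nonneg (α / ((n : ℝ) + 1))
          linarith
      _ = _ := mul_one _

/-- The shifted index makes the induction close: the ratio of consecutive numbers is exactly the
Bernoulli bound for ((n+1)/(n+2))^α. -/
lemma le_cesaroA_neg_succ {α : ℝ} (hα : α ∈ Set.Ioo (0 : ℝ) 1) (n : ℕ) :
    (1 - α) * ((n : ℝ) + 1) ^ (-α) ≤ cesaroA (-α) (n + 1) := by
  induction n with
  | zero => rw [cesaroA_succ]; simp [cesaroA_zero, add_comm, sub_eq_add_neg]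
  | succ n ih =>
    rw [cesaroA_succ]
    have hn : (0 : ℝ) < n + 1 := by positivity
    have hn' : (0 : ℝ) < n + 1 + 1 := by positivity
    have hx : (0 : ℝ) < 1 + -1 / ((n : ℝ) + 1 + 1) := by
      rw [neg_div, ← sub_eq_add_neg, sub_pos, div_lt_one hn']
      linarith
    have hb : (1 + -1 / ((n : ℝ) + 1 + 1)) ^ α ≤ 1 + α * (-1 / (n + 1 + 1)) :=
      rpow_one_add_le_one_add_mul_self (by linarith) hα.1.le hα.2.le
    have he : ((n : ℝ) + 1) ^ (-α) =
        (n + 1 + 1 : ℝ) ^ (-α) / (1 + -1 / ((n : ℝ) + 1 + 1)) ^ α := by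
      have : (n : ℝ) + 1 = (n + 1 + 1) * (1 + -1 / (n + 1 + 1)) := by field_simp; ring
      conv_lhs => rw [this]
      rw [Real.mul_rpow hn'.le hx.le, Real.rpow_neg hx.le]
      rfl
    have hp : 0 < (1 + -1 / ((n : ℝ) + 1 + 1)) ^ α := Real.rpow_pos_of_pos hx _
    rw [he, ← mul_div_assoc, div_le_iff₀ hp] at ih
    push_cast
    calc (1 - α) * ((n : ℝ) + 1 + 1) ^ (-α)
        ≤ cesaroA (-α) (n + 1) * (1 + -1 / ((n : ℝ) + 1 + 1)) ^ α := ih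
      _ ≤ cesaroA (-α) (n + 1) * (1 + α * (-1 / (n + 1 + 1))) :=
          mul_le_mul_of_nonneg_left hb (cesaroA_neg_pos hα _).le
      _ = _ := by
          congr 1
          field_simp
          ring

lemma le_cesaroA_neg {α : ℝ} (hα : α ∈ Set.Ioo (0 : ℝ) 1) (n : ℕ) :
    (1 - α) * ((n : ℝ) + 1) ^ (-α) ≤ cesaroA (-α) n := by
  cases n with
  | zero => simp [cesaroA_zero]; linarith [hα.1]
  | succ n =>
    refine le_trans ?_ (le_cesaroA_neg_succ hα n)
    push_cast
    refine mul_le_mul_of_nonneg_left ?_ (by linarith [hα.2])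
    exact Real.rpow_le_rpow_of_nonpos (by positivity) (by linarith) (by linarith [hα.1])

lemma sum_rpow_neg_le {α : ℝ} (hα : α ∈ Set.Ioo (0 : ℝ) 1) (n : ℕ) :
    ∑ i ∈ Finset.range n, ((i : ℝ) + 1) ^ (-α) ≤ (n : ℝ) ^ (1 - α) / (1 - α) := by
  have h1 : 0 < 1 - α := by linarith [hα.2]
  induction n with
  | zero => simp [Real.zero_rpow h1.ne']
  | succ n ih =>
    rw [Finset.sum_range_succ]
    refine (add_le_add_left ih _).trans ?_
    rw [le_div_iff₀ h1, add_mul, div_mul_cancel₀ _ h1.ne']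
    push_cast
    have hn' : (0 : ℝ) < n + 1 := by positivity
    have hx : (0 : ℝ) ≤ 1 + -1 / ((n : ℝ) + 1) := by
      rw [neg_div, ← sub_eq_add_neg, sub_nonneg, div_le_one hn']
      linarith [(by positivity : (0 : ℝ) ≤ n)]
    have hb : (1 + -1 / ((n : ℝ) + 1)) ^ (1 - α) ≤ 1 + (1 - α) * (-1 / (n + 1)) :=
      rpow_one_add_le_one_add_mul_self (by linarith) h1.le (by linarith [hα.1])
    have he : (n : ℝ) ^ (1 - α) = (n + 1 : ℝ) ^ (1 - α) * (1 + -1 / ((n : ℝ) + 1)) ^ (1 - α) := by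
      rw [← Real.mul_rpow hn'.le hx]
      congr 1
      field_simp
      ring
    have hs : ((n : ℝ) + 1) ^ (-α) = (n + 1 : ℝ) ^ (1 - α) / (n + 1) := by
      rw [show (-α) = (1 - α) - 1 by ring, Real.rpow_sub_one hn'.ne']
    have hP : 0 ≤ (n + 1 : ℝ) ^ (1 - α) := Real.rpow_nonneg hn'.le _
    rw [he, hs]
    have := mul_le_mul_of_nonneg_left hb hP
    refine (add_le_add_left this _).trans (le_of_eq ?_)
    field_simp
    ring

lemma inv_cesaroA_neg_le {α : ℝ} (hα : α ∈ Set.Ioo (0 : ℝ) 1) {n : ℕ} (hn : 1 ≤ n) :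
    1 / cesaroA (-α) (n - 1) ≤ (n : ℝ) ^ α / (1 - α) := by
  have h1 : 0 < 1 - α := by linarith [hα.2]
  have h := le_cesaroA_neg hα (n - 1)
  have hc : ((n - 1 : ℕ) : ℝ) + 1 = n := by rw [Nat.cast_sub hn]; simp
  have hn0 : (0 : ℝ) < n := by exact_mod_cast hn
  rw [hc, Real.rpow_neg hn0.le] at h
  have hp : 0 < (n : ℝ) ^ α := Real.rpow_pos_of_pos hn0 _
  rw [div_le_div_iff₀ (cesaroA_neg_pos hα _) h1]
  rw [mul_inv_le_iff₀ hp] at h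
  linarith

/-! ### Coefficients of the kernel relative to the Dirichlet kernel of order `2ᵖ` -/

/-- The coefficient of `w_k` in the Cesàro kernel minus its coefficient in the Dirichlet kernel
of order `2 ^ Nat.log 2 n`. -/
noncomputable def excess (α : ℝ) (n k : ℕ) : ℝ :=
  cesaroA (-α) (n - 1 - k) / cesaroA (-α) (n - 1) - if k < 2 ^ Nat.log 2 n then 1 else 0

/-- The number of terms of the Cesàro kernel of order `n` with index in `[2ᵠ, 2ᵠ⁺¹)`. -/
def blockLen (n q : ℕ) : ℕ := min (2 ^ q) (n - 2 ^ q)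

/-- Each of the `k` steps lowers the current number A_l by αA_l/(l+1), and A_l/(l+1) is largest at l
= `j`. -/
lemma cesaroA_neg_sub_le {α : ℝ} (hα : α ∈ Set.Ioo (0 : ℝ) 1) (j k : ℕ) :
    cesaroA (-α) j - cesaroA (-α) (j + k) ≤ k * (cesaroA (-α) j / (j + 1)) := by
  induction k with
  | zero => simp
  | succ k ih =>
    have h := cesaroA_neg_sub_succ α (j + k)
    have h1 : cesaroA (-α) (j + k) ≤ cesaroA (-α) j :=
      cesaroA_neg_antitone hα (Nat.le_add_right j k)
    have h0 := cesaroA_neg_pos hα j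
    have h2 : cesaroA (-α) (j + k) * (α / ((j + k : ℕ) + 1)) ≤ cesaroA (-α) j / (j + 1) := by
      rw [← mul_div_assoc]
      refine div_le_div₀ h0.le ?_ (by positivity) (by push_cast; linarith [(by positivity : (0 : ℝ) ≤ k)])
      have := cesaroA_neg_pos hα (j + k)
      nlinarith [hα.1, hα.2]
    rw [← add_assoc]
    push_cast at h h2 ⊢
    rw [add_mul, one_mul]
    linarith

lemma two_pow_add_blockLen_le {n q : ℕ} (hn : n ≠ 0) (hq : q ≤ Nat.log 2 n) :
    2 ^ q + blockLen n q ≤ n := by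
  have h1 : 2 ^ Nat.log 2 n ≤ n := Nat.pow_log_le_self 2 hn
  have h2 : 2 ^ q ≤ 2 ^ Nat.log 2 n := Nat.pow_le_pow_right (by norm_num) hq
  have h3 : blockLen n q ≤ n - 2 ^ q := min_le_right _ _
  omega

lemma blockLen_le (n q : ℕ) : blockLen n q ≤ 2 ^ q := min_le_left _ _

lemma blockLen_of_lt {n q : ℕ} (hn : n ≠ 0) (hq : q < Nat.log 2 n) : blockLen n q = 2 ^ q := by
  have h1 : 2 ^ Nat.log 2 n ≤ n := Nat.pow_log_le_self 2 hn
  have h2 : 2 ^ (q + 1) ≤ 2 ^ Nat.log 2 n := Nat.pow_le_pow_right (by norm_num) hq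
  rw [pow_succ] at h2
  exact min_eq_left (by omega)

lemma blockLen_log {n : ℕ} (hn : n ≠ 0) : 2 ^ Nat.log 2 n + blockLen n (Nat.log 2 n) = n := by
  have h1 : 2 ^ Nat.log 2 n ≤ n := Nat.pow_log_le_self 2 hn
  have h2 : n < 2 ^ (Nat.log 2 n + 1) := Nat.lt_pow_succ_log_self (by norm_num) n
  rw [pow_succ] at h2
  unfold blockLen
  omega

lemma sum_range_eq_sum_blocks {n : ℕ} (hn : n ≠ 0) (g : ℕ → ℝ) :
    ∑ k ∈ Finset.range n, g k =
      g 0 + ∑ q ∈ Finset.range (Nat.log 2 n + 1), ∑ r ∈ Finset.range (blockLen n q),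
        g (2 ^ q + r) := by
  have key : ∀ Q ≤ Nat.log 2 n, ∑ k ∈ Finset.range (2 ^ Q), g k =
      g 0 + ∑ q ∈ Finset.range Q, ∑ r ∈ Finset.range (blockLen n q), g (2 ^ q + r) := by
    intro Q
    induction Q with
    | zero => simp
    | succ Q ih =>
      intro hQ
      rw [pow_succ, mul_two, Finset.sum_range_add, ih (by omega), Finset.sum_range_succ,
        blockLen_of_lt hn hQ, add_assoc]
  conv_lhs => rw [← blockLen_log hn]
  rw [Finset.sum_range_add, key _ le_rfl, Finset.sum_range_succ, add_assoc]

lemma excess_zero {α : ℝ} (hα : α ∈ Set.Ioo (0 : ℝ) 1) (n : ℕ) : excess α n 0 = 0 := by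
  simp [excess, (cesaroA_neg_pos hα (n - 1)).ne']

lemma lt_two_pow_log_iff {n q r : ℕ} (hq : q ≤ Nat.log 2 n) (hr : r < 2 ^ q) :
    2 ^ q + r < 2 ^ Nat.log 2 n ↔ q < Nat.log 2 n := by
  constructor
  · intro h
    rcases hq.lt_or_eq with h1 | h1
    · exact h1
    · rw [h1] at h
      omega
  · intro h
    have h2 : 2 ^ (q + 1) ≤ 2 ^ Nat.log 2 n := Nat.pow_le_pow_right (by norm_num) h
    rw [pow_succ] at h2
    omega

/-- Larger frequencies have Cesàro numbers of smaller index, and these are larger; inside one block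
the subtracted Dirichlet coefficient is constant. -/
lemma excess_le_excess {α : ℝ} (hα : α ∈ Set.Ioo (0 : ℝ) 1) {n q r r' : ℕ}
    (hq : q ≤ Nat.log 2 n) (hr' : r' < 2 ^ q) (h : r ≤ r') :
    excess α n (2 ^ q + r) ≤ excess α n (2 ^ q + r') := by
  unfold excess
  simp only [lt_two_pow_log_iff hq hr', lt_two_pow_log_iff hq (h.trans_lt hr')]
  have := cesaroA_neg_antitone hα (show n - 1 - (2 ^ q + r') ≤ n - 1 - (2 ^ q + r) by omega)
  have h0 := cesaroA_neg_pos hα (n - 1)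
  gcongr

lemma excess_nonneg {α : ℝ} (hα : α ∈ Set.Ioo (0 : ℝ) 1) (n k : ℕ) : 0 ≤ excess α n k := by
  unfold excess
  have h0 := cesaroA_neg_pos hα (n - 1)
  have h1 := cesaroA_neg_antitone hα (show n - 1 - k ≤ n - 1 by omega)
  have : 1 ≤ cesaroA (-α) (n - 1 - k) / cesaroA (-α) (n - 1) := by
    rwa [one_le_div h0]
  split_ifs <;> linarith

lemma rpow_le_self_of_one_le {x α : ℝ} (hα : α ∈ Set.Ioo (0 : ℝ) 1) (hx : 1 ≤ x) : x ^ α ≤ x := by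
  conv_rhs => rw [← Real.rpow_one x]
  exact Real.rpow_le_rpow_of_exponent_le hx hα.2.le

/-- Here `i` is the distance to the last term of the block. In the two top blocks 1/A_{n-1} is of
order 2^{qα}, and the numerator is at most (i+1)^{-α}. Lower blocks are far from the end of the
kernel: the coefficient differs from 1 by O(k/n), whence the factor 2^q/2^p. -/
lemma excess_block_le {α : ℝ} (hα : α ∈ Set.Ioo (0 : ℝ) 1) {n q i : ℕ} (hn : n ≠ 0)
    (hq : q ≤ Nat.log 2 n) (hi : i < blockLen n q) :
    excess α n (2 ^ q + (blockLen n q - 1 - i)) ≤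
      8 / (1 - α) * (2 ^ q / 2 ^ Nat.log 2 n * ((2 : ℝ) ^ q) ^ α) * ((i : ℝ) + 1) ^ (-α) := by
  have h1α : 0 < 1 - α := by linarith [hα.2]
  have hm := two_pow_add_blockLen_le hn hq
  have hm' := blockLen_le n q
  set m := blockLen n q with hmd
  set k := 2 ^ q + (m - 1 - i) with hkd
  set p := Nat.log 2 n with hpd
  have hpn : 2 ^ p ≤ n := Nat.pow_log_le_self 2 hn
  have hnp : n < 2 ^ (p + 1) := Nat.lt_pow_succ_log_self (by norm_num) n
  have ha0 := cesaroA_neg_pos hα (n - 1)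
  have hinv := inv_cesaroA_neg_le hα (Nat.one_le_iff_ne_zero.2 hn)
  have hn0 : (0 : ℝ) < n := by exact_mod_cast Nat.pos_of_ne_zero hn
  have hq0 : (0 : ℝ) < 2 ^ q := by positivity
  have hp0 : (0 : ℝ) < 2 ^ p := by positivity
  have hqα : 0 < ((2 : ℝ) ^ q) ^ α := Real.rpow_pos_of_pos hq0 _
  have hiα : 0 < ((i : ℝ) + 1) ^ (-α) := Real.rpow_pos_of_pos (by positivity) _
  rcases le_or_gt p (q + 1) with hpq | hpq
  · have h1 : excess α n k ≤ cesaroA (-α) (n - 1 - k) * (1 / cesaroA (-α) (n - 1)) := by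
      unfold excess
      rw [mul_one_div]
      split_ifs <;> linarith
    have h2 : cesaroA (-α) (n - 1 - k) ≤ ((i : ℝ) + 1) ^ (-α) :=
      (cesaroA_neg_antitone hα (show i ≤ n - 1 - k by omega)).trans (cesaroA_neg_le hα i)
    have h3 : (n : ℝ) ≤ 4 * 2 ^ q := by
      have : 2 ^ (p + 1) ≤ 2 ^ (q + 2) := Nat.pow_le_pow_right (by norm_num) (by omega)
      have h' : 2 ^ (q + 2) = 4 * 2 ^ q := by ring
      have : n ≤ 4 * 2 ^ q := by omega
      exact_mod_cast this
    have h4 : (n : ℝ) ^ α ≤ 4 * ((2 : ℝ) ^ q) ^ α := by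
      refine (Real.rpow_le_rpow hn0.le h3 hα.1.le).trans ?_
      rw [Real.mul_rpow (by norm_num) hq0.le]
      gcongr
      exact rpow_le_self_of_one_le hα (by norm_num)
    have h5 : (1 : ℝ) ≤ 2 * (2 ^ q / 2 ^ p) := by
      rw [← mul_div_assoc, one_le_div hp0]
      have : 2 ^ p ≤ 2 ^ (q + 1) := Nat.pow_le_pow_right (by norm_num) hpq
      rw [pow_succ, mul_comm] at this
      exact_mod_cast this
    calc excess α n k ≤ ((i : ℝ) + 1) ^ (-α) * ((n : ℝ) ^ α / (1 - α)) :=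
          h1.trans (mul_le_mul h2 hinv (by positivity) hiα.le)
      _ ≤ ((i : ℝ) + 1) ^ (-α) * (4 * ((2 : ℝ) ^ q) ^ α * (2 * (2 ^ q / 2 ^ p)) / (1 - α)) := by
          gcongr
          exact h4.trans (le_mul_of_one_le_right (by positivity) h5)
      _ = _ := by ring
  · have hk2 : k < 2 * 2 ^ q := by omega
    have h4q : 2 ^ (q + 2) ≤ 2 ^ p := Nat.pow_le_pow_right (by norm_num) hpq
    rw [pow_add] at h4q
    have hkn : 2 * k ≤ n := by omega
    have hkp : k < 2 ^ p := by omega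
    have h1 : excess α n k = (cesaroA (-α) (n - 1 - k) - cesaroA (-α) (n - 1)) *
        (1 / cesaroA (-α) (n - 1)) := by
      unfold excess
      rw [if_pos hkp]
      field_simp
    have h2 := cesaroA_neg_sub_le hα (n - 1 - k) k
    rw [show n - 1 - k + k = n - 1 by omega] at h2
    have h3 := cesaroA_neg_le hα (n - 1 - k)
    have hc : ((n - 1 - k : ℕ) : ℝ) + 1 = n - k := by
      have : n - 1 - k + 1 + k = n := by omega
      have : ((n - 1 - k + 1 + k : ℕ) : ℝ) = n := by rw [this]
      push_cast at this
      linarith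
    rw [hc] at h2 h3
    have hnk : (n : ℝ) / 2 ≤ n - k := by
      have : (2 : ℝ) * k ≤ n := by exact_mod_cast hkn
      linarith
    have h4 : ((n : ℝ) - k) ^ (-α) ≤ 2 * (n : ℝ) ^ (-α) := by
      refine (Real.rpow_le_rpow_of_nonpos (by positivity) hnk (by linarith [hα.1])).trans ?_
      rw [Real.div_rpow hn0.le (by norm_num), Real.rpow_neg (by norm_num : (0 : ℝ) ≤ 2),
        div_inv_eq_mul, mul_comm]
      have := rpow_le_self_of_one_le hα (by norm_num : (1 : ℝ) ≤ 2)
      gcongr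
    have hnα : 0 < (n : ℝ) ^ (-α) := Real.rpow_pos_of_pos hn0 _
    have h5 : cesaroA (-α) (n - 1 - k) - cesaroA (-α) (n - 1) ≤
        k * (2 * (n : ℝ) ^ (-α) / (n / 2)) := by
      refine h2.trans ?_
      gcongr
      exact h3.trans h4
    have h6 : (n : ℝ) ^ (-α) * (n : ℝ) ^ α = 1 := by
      rw [← Real.rpow_add hn0]; simp
    have h7 : (k : ℝ) / n ≤ 2 * (2 ^ q / 2 ^ p) := by
      rw [← mul_div_assoc]
      refine div_le_div₀ (by positivity) ?_ hp0 ?_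
      · exact_mod_cast hk2.le
      · exact_mod_cast hpn
    -- Away from the end of the kernel no singular factor arises; it may be inserted because it is
    -- at least one.
    have h8 : (1 : ℝ) ≤ ((2 : ℝ) ^ q) ^ α * ((i : ℝ) + 1) ^ (-α) := by
      rw [Real.rpow_neg (by positivity), ← div_eq_mul_inv,
        one_le_div (Real.rpow_pos_of_pos (by positivity) _)]
      refine Real.rpow_le_rpow (by positivity) ?_ hα.1.le
      have : i + 1 ≤ 2 ^ q := by omega
      exact_mod_cast this
    have hnα' : 0 < (n : ℝ) ^ α := Real.rpow_pos_of_pos hn0 _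
    calc excess α n k
        ≤ k * (2 * (n : ℝ) ^ (-α) / (n / 2)) * ((n : ℝ) ^ α / (1 - α)) := by
          rw [h1]
          exact mul_le_mul h5 hinv (by positivity) (by positivity)
      _ = 4 * (k / n) * ((n : ℝ) ^ (-α) * (n : ℝ) ^ α) / (1 - α) := by
          field_simp
          ring
      _ ≤ 4 * (2 * (2 ^ q / 2 ^ p)) * (((2 : ℝ) ^ q) ^ α * ((i : ℝ) + 1) ^ (-α)) / (1 - α) := by
          rw [h6]
          gcongr
      _ = _ := by ring

/-! ### Summation by parts -/

/-- Abel summation: the differences bounded in `key` accumulate the increments of `c`, which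
telescope. -/
lemma abs_sum_mul_le_of_monotone {c χ : ℕ → ℝ} {B : ℝ} (m : ℕ)
    (hc0 : ∀ r ≤ m, 0 ≤ c r) (hc : ∀ r < m, c r ≤ c (r + 1))
    (hB : ∀ l ≤ m + 1, |∑ r ∈ Finset.range l, χ r| ≤ B) :
    |∑ r ∈ Finset.range (m + 1), c r * χ r| ≤ 2 * c m * B := by
  have key : ∀ l ≤ m, |∑ r ∈ Finset.range (l + 1), c r * χ r -
      c l * ∑ r ∈ Finset.range (l + 1), χ r| ≤ c l * B := by
    intro l
    induction l with
    | zero =>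
      intro _
      have := hB 0 (by omega)
      simp at this
      simpa using mul_nonneg (hc0 0 (by omega)) this
    | succ l ih =>
      intro hl
      have h1 := ih (by omega)
      have h2 := hc l (by omega)
      have h3 := hB (l + 1) (by omega)
      have e : ∑ r ∈ Finset.range (l + 1 + 1), c r * χ r -
          c (l + 1) * ∑ r ∈ Finset.range (l + 1 + 1), χ r =
          (∑ r ∈ Finset.range (l + 1), c r * χ r - c l * ∑ r ∈ Finset.range (l + 1), χ r) -
          (c (l + 1) - c l) * ∑ r ∈ Finset.range (l + 1), χ r := by
        rw [Finset.sum_range_succ _ (l + 1), Finset.sum_range_succ _ (l + 1)]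
        ring
      rw [e]
      refine (abs_sub _ _).trans ?_
      rw [abs_mul, abs_of_nonneg (sub_nonneg.2 h2)]
      have := mul_le_mul_of_nonneg_left h3 (sub_nonneg.2 h2)
      linarith
  have h1 := key m le_rfl
  have h2 : |c m * ∑ r ∈ Finset.range (m + 1), χ r| ≤ c m * B := by
    rw [abs_mul, abs_of_nonneg (hc0 m le_rfl)]
    exact mul_le_mul_of_nonneg_left (hB _ le_rfl) (hc0 m le_rfl)
  have h3 := abs_add_le (∑ r ∈ Finset.range (m + 1), c r * χ r -
      c m * ∑ r ∈ Finset.range (m + 1), χ r) (c m * ∑ r ∈ Finset.range (m + 1), χ r)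
  rw [sub_add_cancel] at h3
  linarith

/-- Abel summation over the whole range would give only the order `H * B`, as the last coefficients
may be as large as `H`. Hence the last `B` terms are estimated by absolute values, and Abel
summation is used before them, where the coefficients are at most H B^{-α}. Both parts have the
order H B^{1-α}. -/
lemma abs_sum_mul_le_of_rpow_bound {α : ℝ} (hα : α ∈ Set.Ioo (0 : ℝ) 1) {c χ : ℕ → ℝ}
    {m B : ℕ} {H : ℝ} (hH : 0 ≤ H) (hB0 : 0 < B) (hc0 : ∀ r < m, 0 ≤ c r)
    (hc : ∀ r, r + 1 < m → c r ≤ c (r + 1))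
    (hcH : ∀ i < m, c (m - 1 - i) ≤ H * ((i : ℝ) + 1) ^ (-α)) (hχ : ∀ r, |χ r| ≤ 1)
    (hB : ∀ l ≤ m, |∑ r ∈ Finset.range l, χ r| ≤ B) :
    |∑ r ∈ Finset.range m, c r * χ r| ≤ (2 + 1 / (1 - α)) * H * (B : ℝ) ^ (1 - α) := by
  have h1α : 0 < 1 - α := by linarith [hα.2]
  have hBr : (0 : ℝ) < B := by exact_mod_cast hB0
  have hBp : 0 < (B : ℝ) ^ (1 - α) := Real.rpow_pos_of_pos hBr _
  have tail : ∀ L ≤ m, |∑ r ∈ Finset.range L, c (m - L + r) * χ (m - L + r)| ≤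
      H * ((L : ℝ) ^ (1 - α) / (1 - α)) := by
    intro L hL
    calc |∑ r ∈ Finset.range L, c (m - L + r) * χ (m - L + r)|
        ≤ ∑ r ∈ Finset.range L, c (m - L + r) := by
          refine (Finset.abs_sum_le_sum_abs _ _).trans (Finset.sum_le_sum fun r hr => ?_)
          have h0 := hc0 (m - L + r) (by have := Finset.mem_range.1 hr; omega)
          rw [abs_mul, abs_of_nonneg h0]
          exact mul_le_of_le_one_right h0 (hχ _)
      _ = ∑ i ∈ Finset.range L, c (m - L + (L - 1 - i)) :=
          (Finset.sum_range_reflect (fun r => c (m - L + r)) L).symm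
      _ ≤ ∑ i ∈ Finset.range L, H * ((i : ℝ) + 1) ^ (-α) := by
          refine Finset.sum_le_sum fun i hi => ?_
          have hi' := Finset.mem_range.1 hi
          rw [show m - L + (L - 1 - i) = m - 1 - i by omega]
          exact hcH i (by omega)
      _ ≤ _ := by
          rw [← Finset.mul_sum]
          exact mul_le_mul_of_nonneg_left (sum_rpow_neg_le hα L) hH
  rcases le_or_gt m B with h | h
  · have ht := tail m le_rfl
    simp only [Nat.sub_self, zero_add] at ht
    refine ht.trans ?_
    have h2 : (m : ℝ) ^ (1 - α) ≤ (B : ℝ) ^ (1 - α) :=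
      Real.rpow_le_rpow (by positivity) (by exact_mod_cast h) h1α.le
    calc H * ((m : ℝ) ^ (1 - α) / (1 - α)) ≤ H * ((B : ℝ) ^ (1 - α) / (1 - α)) := by gcongr
      _ = (0 + 1 / (1 - α)) * H * (B : ℝ) ^ (1 - α) := by ring
      _ ≤ _ := by gcongr; norm_num
  · have ht := tail B h.le
    -- The length m - B is written as a successor, the form in which the Abel estimate takes its
    -- range.
    have e : m = (m - 1 - B + 1) + B := by omega
    have e' : m - B = m - 1 - B + 1 := by omega
    have h1 : |∑ r ∈ Finset.range (m - 1 - B + 1), c r * χ r| ≤ 2 * c (m - 1 - B) * B :=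
      abs_sum_mul_le_of_monotone _ (fun r hr => hc0 r (by omega)) (fun r hr => hc r (by omega))
        (fun l hl => hB l (by omega))
    have h2 : c (m - 1 - B) ≤ H * (B : ℝ) ^ (-α) := by
      refine (hcH B h).trans (mul_le_mul_of_nonneg_left ?_ hH)
      exact Real.rpow_le_rpow_of_nonpos hBr (by linarith) (by linarith [hα.1])
    have h3 : (B : ℝ) ^ (-α) * B = (B : ℝ) ^ (1 - α) := by
      rw [← Real.rpow_add_one hBr.ne']
      congr 1
      ring
    rw [e'] at ht
    conv_lhs => rw [e, Finset.sum_range_add]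
    refine (abs_add_le _ _).trans ?_
    calc _ ≤ 2 * (H * (B : ℝ) ^ (-α)) * B + H * ((B : ℝ) ^ (1 - α) / (1 - α)) := by
          refine add_le_add (h1.trans ?_) ht
          gcongr
      _ = 2 * H * ((B : ℝ) ^ (-α) * B) + H * ((B : ℝ) ^ (1 - α) / (1 - α)) := by ring
      _ = _ := by rw [h3]; ring

/-! ### Dyadic blocks of the kernel -/

/-- The part of the Cesàro kernel minus the Dirichlet kernel with frequencies in
`[2ᵠ, 2ᵠ⁺¹)`. -/
noncomputable def blockKernel (α : ℝ) (n : ℕ) (x : ℝ) (q : ℕ) (s : ℝ) : ℝ :=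
  ∑ r ∈ Finset.range (blockLen n q), excess α n (2 ^ q + r) * walshPair x s (2 ^ q + r)

lemma measurable_walshPair (x : ℝ) (k : ℕ) : Measurable fun s => walshPair x s k :=
  (measurable_walsh k).const_mul _

lemma measurable_blockKernel (α : ℝ) (n : ℕ) (x : ℝ) (q : ℕ) :
    Measurable (blockKernel α n x q) :=
  Finset.measurable_sum _ fun _ _ => (measurable_walshPair x _).const_mul _

lemma walshPair_two_pow_add {x s : ℝ} {q r : ℕ} (hr : r < 2 ^ q) :
    walshPair x s (2 ^ q + r) = walshPair x s (2 ^ q) * walshPair x s r := by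
  simpa using walshPair_two_pow_mul_add x s q 1 hr

/-- The common factor w_{2^q}(x) w_{2^q}(s) of the block has modulus one, so only partial sums of
the Dirichlet kernel up to order 2^q matter. -/
lemma abs_blockKernel_le {α : ℝ} (hα : α ∈ Set.Ioo (0 : ℝ) 1) {n q B : ℕ} (hn : n ≠ 0)
    (hq : q ≤ Nat.log 2 n) (hB0 : 0 < B) {x s : ℝ}
    (hB : ∀ l ≤ 2 ^ q, |∑ r ∈ Finset.range l, walshPair x s r| ≤ B) :
    |blockKernel α n x q s| ≤ (2 + 1 / (1 - α)) *
      (8 / (1 - α) * (2 ^ q / 2 ^ Nat.log 2 n * ((2 : ℝ) ^ q) ^ α)) * (B : ℝ) ^ (1 - α) := by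
  have h1α : 0 < 1 - α := by linarith [hα.2]
  have hm := blockLen_le n q
  unfold blockKernel
  refine abs_sum_mul_le_of_rpow_bound hα (c := fun r => excess α n (2 ^ q + r))
    (χ := fun r => walshPair x s (2 ^ q + r)) (by positivity) hB0
    (fun _ _ => excess_nonneg hα _ _) (fun _ hr => excess_le_excess hα hq (by omega) (by omega))
    (fun i hi => excess_block_le hα hn hq hi) (fun _ => (abs_walshPair x s _).le) fun l hl => ?_
  rw [Finset.sum_congr rfl fun r hr => walshPair_two_pow_add (x := x) (s := s) (q := q)
    (by have := Finset.mem_range.1 hr; omega), ← Finset.mul_sum, abs_mul, abs_walshPair, one_mul]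
  exact hB l (by omega)

/-- The points of the dyadic interval of length `2⁻⁽ᵠ⁻ᵈ⁾` around `x` that, for `d ≥ 1`, are not in
the half of it that contains `x`. -/
def shell (x : ℝ) (q d : ℕ) : Set ℝ :=
  {s | cell (q - d) s = cell (q - d) x ∧ (d = 0 ∨ cell (q - d + 1) s ≠ cell (q - d + 1) x)}

lemma measurableSet_cell_eq (j e : ℕ) : MeasurableSet {s | cell j s = e} :=
  measurable_cell j (measurableSet_singleton e)

lemma measurableSet_shell (x : ℝ) (q d : ℕ) : MeasurableSet (shell x q d) := by
  refine (measurableSet_cell_eq _ _).inter ?_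
  exact (MeasurableSet.const (d = 0)).union (measurableSet_cell_eq _ _).compl

/-- The constant in the pointwise kernel estimate. -/
noncomputable def kernelConst (α : ℝ) : ℝ := 2 * (2 + 1 / (1 - α)) * (8 / (1 - α))

lemma kernelConst_pos {α : ℝ} (hα : α ∈ Set.Ioo (0 : ℝ) 1) : 0 < kernelConst α := by
  have h1α : 0 < 1 - α := by linarith [hα.2]
  unfold kernelConst
  positivity

lemma abs_blockKernel_le_of_mem_shell {α : ℝ} (hα : α ∈ Set.Ioo (0 : ℝ) 1) {n q d : ℕ}
    (hn : n ≠ 0) (hq : q ≤ Nat.log 2 n) (hd : d ≤ q) {x s : ℝ} (hx : x ∈ I) (hs : s ∈ I)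
    (h : s ∈ shell x q d) :
    |blockKernel α n x q s| ≤
      kernelConst α * (2 ^ q / 2 ^ Nat.log 2 n) * 2 ^ q * ((2 : ℝ) ^ d) ^ (α - 1) := by
  have h1α : 0 < 1 - α := by linarith [hα.2]
  have hB : ∀ l ≤ 2 ^ q, |∑ r ∈ Finset.range l, walshPair x s r| ≤ (2 ^ (q - d + 1) : ℕ) := by
    intro l hl
    push_cast
    rcases h.2 with h0 | h0
    -- In the innermost shell no level of separation is available, and the trivial bound by the
    -- number of terms suffices.
    · refine (abs_sum_walshPair_le _ _ _).trans ?_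
      rw [Finset.card_range, h0]
      have : l ≤ 2 ^ (q - 0 + 1) := by rw [Nat.sub_zero, pow_succ]; omega
      exact_mod_cast this
    · exact abs_sum_range_walshPair_le hx.1 hs.1 h.1 h0 l
  refine (abs_blockKernel_le hα hn hq (by positivity) hB).trans ?_
  have hq0 : (0 : ℝ) < 2 ^ q := by positivity
  have hd0 : (0 : ℝ) < 2 ^ d := by positivity
  have e : ((2 ^ (q - d + 1) : ℕ) : ℝ) = 2 * (2 ^ q / 2 ^ d) := by
    push_cast
    rw [pow_succ, mul_comm, pow_sub₀ _ (by norm_num) hd]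
    rfl
  have h2 : ((2 : ℝ) ^ q) ^ α * ((2 ^ (q - d + 1) : ℕ) : ℝ) ^ (1 - α) ≤
      2 * (2 ^ q * ((2 : ℝ) ^ d) ^ (α - 1)) := by
    rw [e, Real.mul_rpow (by norm_num) (by positivity), Real.div_rpow hq0.le hd0.le,
      show α - 1 = -(1 - α) by ring, Real.rpow_neg hd0.le]
    have h3 : ((2 : ℝ) ^ q) ^ α * ((2 : ℝ) ^ q) ^ (1 - α) = 2 ^ q := by
      rw [← Real.rpow_add hq0]
      simp
    have h4 : (2 : ℝ) ^ (1 - α) ≤ 2 :=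
      rpow_le_self_of_one_le ⟨h1α, by linarith [hα.1]⟩ (by norm_num)
    have h5 : 0 < ((2 : ℝ) ^ d) ^ (1 - α) := Real.rpow_pos_of_pos hd0 _
    calc _ = (2 : ℝ) ^ (1 - α) * ((((2 : ℝ) ^ q) ^ α * ((2 : ℝ) ^ q) ^ (1 - α)) *
          (((2 : ℝ) ^ d) ^ (1 - α))⁻¹) := by ring
      _ ≤ _ := by
        rw [h3]
        gcongr
  calc _ = (2 + 1 / (1 - α)) * (8 / (1 - α)) * (2 ^ q / 2 ^ Nat.log 2 n) *
        (((2 : ℝ) ^ q) ^ α * ((2 ^ (q - d + 1) : ℕ) : ℝ) ^ (1 - α)) := by ring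
    _ ≤ (2 + 1 / (1 - α)) * (8 / (1 - α)) * (2 ^ q / 2 ^ Nat.log 2 n) *
        (2 * (2 ^ q * ((2 : ℝ) ^ d) ^ (α - 1))) := by
      gcongr
    _ = _ := by unfold kernelConst; ring

/-- The shells partition `I`: a point that separates from x at a level j < q lies only in the shell
d = q - j, every other point only in the shell d = 0. -/
lemma sum_indicator_shell {x s : ℝ} (hx : x ∈ I) (hs : s ∈ I) (q : ℕ) :
    ∑ d ∈ Finset.range (q + 1), (shell x q d).indicator (fun _ => (1 : ℝ)) s = 1 := by
  by_cases h : cell q s = cell q x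
  · rw [Finset.sum_eq_single 0]
    · rw [Set.indicator_of_mem]
      exact ⟨h, Or.inl rfl⟩
    · intro d hd hd0
      rw [Set.indicator_of_notMem]
      rintro ⟨_, h2⟩
      have := Finset.mem_range.1 hd
      rcases h2 with h2 | h2
      · exact hd0 h2
      · exact h2 (cell_mono_eq (by omega) h)
    · simp
  · obtain ⟨j, hj, h1, h2⟩ := exists_separating_level hx hs h
    rw [Finset.sum_eq_single (q - j)]
    · rw [Set.indicator_of_mem]
      refine ⟨?_, Or.inr ?_⟩
      · rw [Nat.sub_sub_self hj.le]; exact h1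
      · rw [Nat.sub_sub_self hj.le]; exact h2
    · intro d hd hdj
      rw [Set.indicator_of_notMem]
      have hd' := Finset.mem_range.1 hd
      rintro ⟨h3, h4⟩
      rcases lt_trichotomy (q - d) j with hlt | heq | hgt
      · rcases h4 with h4 | h4
        · omega
        · exact h4 (cell_mono_eq (by omega) h1)
      · omega
      · exact h2 (cell_mono_eq (by omega) h3)
    · intro h3
      exact absurd (Finset.mem_range.2 (by omega)) h3

/-! ### Averaging over a grid -/

lemma measurableSet_I : MeasurableSet I := measurableSet_Ico

lemma measurableSet_I2 : MeasurableSet I2 := measurableSet_I.prod measurableSet_I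

/-- The translate by `τ` of the `c`-th point of the grid of mesh `1 / M`. -/
noncomputable def gridPoint (M c : ℕ) (τ : ℝ) : ℝ := c / M + τ

lemma gridPoint_mem_I {M c : ℕ} (hc : c < M) {τ : ℝ} (hτ : τ ∈ Set.Ico (0 : ℝ) (1 / M)) :
    gridPoint M c τ ∈ I := by
  unfold gridPoint
  have hM : (0 : ℝ) < M := by exact_mod_cast (Nat.zero_le c).trans_lt hc
  constructor
  · have := hτ.1; positivity
  · have h1 : ((c : ℝ) + 1) / M ≤ 1 := by
      rw [div_le_one hM]
      exact_mod_cast hc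
    rw [add_div] at h1
    linarith [hτ.2]

lemma preimage_add_left_Ico (c M : ℕ) :
    (fun τ : ℝ => (c : ℝ) / M + τ) ⁻¹' Set.Ico ((c : ℝ) / M) ((c + 1 : ℝ) / M) =
      Set.Ico (0 : ℝ) (1 / M) := by
  ext τ
  simp only [Set.mem_preimage, Set.mem_Ico, add_div]
  constructor <;> rintro ⟨h1, h2⟩ <;> constructor <;> linarith

lemma mem_Ico_div_iff {M c : ℕ} (hM : 0 < M) {s : ℝ} (hs : 0 ≤ s) :
    s ∈ Set.Ico ((c : ℝ) / M) ((c + 1 : ℝ) / M) ↔ ⌊(M : ℝ) * s⌋₊ = c := by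
  have h0 : (0 : ℝ) < M := by exact_mod_cast hM
  rw [Nat.floor_eq_iff (by positivity), Set.mem_Ico, div_le_iff₀ h0, lt_div_iff₀ h0, mul_comm s]

/-- The integral over the square is the integral over a single tile, of area 1/(MN), of the sum of
`F` over a translated grid. This replaces integrals by sums of point values, to which the variation
applies. -/
lemma abs_integral_I2_le_of_tile {M N : ℕ} (hM : 0 < M) (hN : 0 < N) {F : ℝ × ℝ → ℝ}
    (hF : IntegrableOn F I2) {B : ℝ}
    (hB : ∀ τ ∈ Set.Ico (0 : ℝ) (1 / M), ∀ τ' ∈ Set.Ico (0 : ℝ) (1 / N),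
      |∑ c ∈ Finset.range M, ∑ c' ∈ Finset.range N, F (gridPoint M c τ, gridPoint N c' τ')| ≤ B) :
    |∫ p in I2, F p| ≤ B / (M * N) := by
  have hM0 : (0 : ℝ) < M := by exact_mod_cast hM
  have hN0 : (0 : ℝ) < N := by exact_mod_cast hN
  let C : ℕ × ℕ → Set (ℝ × ℝ) := fun c =>
    Set.Ico ((c.1 : ℝ) / M) ((c.1 + 1 : ℝ) / M) ×ˢ Set.Ico ((c.2 : ℝ) / N) ((c.2 + 1 : ℝ) / N)
  let T : Set (ℝ × ℝ) := Set.Ico (0 : ℝ) (1 / M) ×ˢ Set.Ico (0 : ℝ) (1 / N)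
  have hCnn : ∀ c, ∀ p ∈ C c, 0 ≤ p.1 ∧ 0 ≤ p.2 := by
    rintro c p ⟨⟨h1, -⟩, ⟨h2, -⟩⟩
    exact ⟨le_trans (by positivity) h1, le_trans (by positivity) h2⟩
  have hmem : ∀ c, ∀ p : ℝ × ℝ, 0 ≤ p.1 → 0 ≤ p.2 →
      (p ∈ C c ↔ ⌊(M : ℝ) * p.1⌋₊ = c.1 ∧ ⌊(N : ℝ) * p.2⌋₊ = c.2) := by
    intro c p h1 h2
    exact and_congr (mem_Ico_div_iff hM h1) (mem_Ico_div_iff hN h2)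
  have hpre : ∀ c : ℕ × ℕ, (fun p : ℝ × ℝ => ((c.1 : ℝ) / M, (c.2 : ℝ) / N) + p) ⁻¹' C c = T := by
    intro c
    change (fun p : ℝ × ℝ => ((c.1 : ℝ) / M + p.1, (c.2 : ℝ) / N + p.2)) ⁻¹' C c = T
    rw [show T = ((fun τ : ℝ => (c.1 : ℝ) / M + τ) ⁻¹' Set.Ico ((c.1 : ℝ) / M) ((c.1 + 1 : ℝ) / M))
      ×ˢ ((fun τ : ℝ => (c.2 : ℝ) / N + τ) ⁻¹' Set.Ico ((c.2 : ℝ) / N) ((c.2 + 1 : ℝ) / N)) by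
        rw [preimage_add_left_Ico, preimage_add_left_Ico]]
    rfl
  have hU : I2 = ⋃ c ∈ Finset.range M ×ˢ Finset.range N, C c := by
    ext p
    simp only [Set.mem_iUnion, Finset.mem_product, Finset.mem_range, exists_prop]
    constructor
    · rintro ⟨h1, h2⟩
      refine ⟨(⌊(M : ℝ) * p.1⌋₊, ⌊(N : ℝ) * p.2⌋₊), ⟨?_, ?_⟩, (hmem _ p h1.1 h2.1).2 ⟨rfl, rfl⟩⟩
      · rw [Nat.floor_lt (mul_nonneg hM0.le h1.1)]
        nlinarith [h1.2]
      · rw [Nat.floor_lt (mul_nonneg hN0.le h2.1)]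
        nlinarith [h2.2]
    · rintro ⟨c, ⟨h1, h2⟩, hp⟩
      have hp' : ((p.1 - (c.1 : ℝ) / M, p.2 - (c.2 : ℝ) / N) : ℝ × ℝ) ∈ T := by
        rw [← hpre c]
        simpa using hp
      have e1 := gridPoint_mem_I h1 hp'.1
      have e2 := gridPoint_mem_I h2 hp'.2
      simp only [gridPoint, add_sub_cancel] at e1 e2
      exact ⟨e1, e2⟩
  have hCm : ∀ c, MeasurableSet (C c) := fun c => measurableSet_Ico.prod measurableSet_Ico
  have hsub : ∀ c ∈ Finset.range M ×ˢ Finset.range N, C c ⊆ I2 := by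
    intro c hc
    rw [hU]
    exact Set.subset_biUnion_of_mem (u := C) hc
  have hmp : ∀ v : ℝ × ℝ, MeasurePreserving (fun p : ℝ × ℝ => v + p) volume volume :=
    fun v => measurePreserving_add_left volume v
  have hemb : ∀ v : ℝ × ℝ, MeasurableEmbedding (fun p : ℝ × ℝ => v + p) :=
    fun v => (MeasurableEquiv.addLeft v).measurableEmbedding
  have hshift : ∀ c : ℕ × ℕ, ∫ p in C c, F p =
      ∫ p in T, F (((c.1 : ℝ) / M, (c.2 : ℝ) / N) + p) := by
    intro c
    rw [← hpre c]
    exact ((hmp _).setIntegral_preimage_emb (hemb _) F (C c)).symm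
  have hint : ∀ c ∈ Finset.range M ×ˢ Finset.range N,
      IntegrableOn (fun p => F (((c.1 : ℝ) / M, (c.2 : ℝ) / N) + p)) T := by
    intro c hc
    rw [← hpre c]
    exact ((hmp _).integrableOn_comp_preimage (hemb _)).2 (hF.mono_set (hsub c hc))
  have hsum : ∫ p in I2, F p = ∫ p in T, ∑ c ∈ Finset.range M ×ˢ Finset.range N,
      F (((c.1 : ℝ) / M, (c.2 : ℝ) / N) + p) := by
    rw [integral_finsetSum _ hint, hU, integral_biUnion_finset _ (fun c _ => hCm c)]
    · exact Finset.sum_congr rfl fun c _ => hshift c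
    · intro c _ c' _ hcc
      refine Set.disjoint_left.2 fun p h1 h2 => hcc ?_
      have h3 := hCnn c p h1
      have h4 := (hmem c p h3.1 h3.2).1 h1
      have h5 := (hmem c' p h3.1 h3.2).1 h2
      exact Prod.ext (h4.1.symm.trans h5.1) (h4.2.symm.trans h5.2)
    · exact fun c hc => hF.mono_set (hsub c hc)
  have hvol : (volume : Measure (ℝ × ℝ)).real T = 1 / (M * N) := by
    rw [Measure.volume_eq_prod, measureReal_prod_prod, Real.volume_real_Ico, Real.volume_real_Ico]
    rw [sub_zero, sub_zero, max_eq_left (by positivity), max_eq_left (by positivity)]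
    field_simp
  have hfin : (volume : Measure (ℝ × ℝ)) T < ∞ := by
    rw [Measure.volume_eq_prod, Measure.prod_prod]
    simp [ENNReal.mul_lt_top]
  rw [hsum, div_eq_mul_one_div, ← hvol, ← Real.norm_eq_abs]
  refine norm_setIntegral_le_of_norm_le_const hfin fun p hp => ?_
  rw [Finset.sum_product]
  exact hB p.1 hp.1 p.2 hp.2

/-! ### Sums of increments -/

/-- Since `L` is increasing, each weight 1/L(k+1) in the sum is at least 1/L(Y.card). -/
lemma sum_le_mul_of_sum_div_le {L : ℕ → ℝ} (hL : Monotone L) (hL0 : 0 ≤ L 0)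
    (hL1 : ∀ k, 0 < L (k + 1)) {V : ℝ} {ι : Type*} (Y : Finset ι) {g : ι → ℝ}
    (hg : ∀ k, 0 ≤ g k)
    (h : ∑ k : Fin Y.card, g (Y.equivFin.symm k) / L (k + 1) ≤ V) :
    ∑ k ∈ Y, g k ≤ L Y.card * V := by
  have h2 : ∑ k ∈ Y, g k = ∑ k : Fin Y.card, g (Y.equivFin.symm k) := by
    rw [← Finset.sum_coe_sort]
    exact (Equiv.sum_comp Y.equivFin.symm fun k : Y => g k).symm
  rw [h2]
  refine le_trans ?_ (mul_le_mul_of_nonneg_left h (hL0.trans (hL (Nat.zero_le _))))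
  rw [Finset.mul_sum]
  refine Finset.sum_le_sum fun k _ => ?_
  rw [mul_div_assoc', le_div_iff₀ (hL1 k), mul_comm]
  exact mul_le_mul_of_nonneg_right (hL k.2) (hg _)

lemma sum_abs_rectDiff_le {L : ℕ → ℝ} (hL : Monotone L) (hL0 : 0 ≤ L 0)
    (hL1 : ∀ k, 0 < L (k + 1)) {f : ℝ × ℝ → ℝ} {V : ℝ} (hV0 : 0 ≤ V)
    (hV : VStar L f ≤ ENNReal.ofReal V) {ι : Type*} (Y : Finset ι) {a b c d : ι → ℝ}
    (hmem : ∀ k ∈ Y, a k ∈ I ∧ b k ∈ I ∧ c k ∈ I ∧ d k ∈ I ∧ a k < b k ∧ c k < d k)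
    (hdisj : ∀ k ∈ Y, ∀ l ∈ Y, k ≠ l → Disjoint (Set.Ioo (a k) (b k) ×ˢ Set.Ioo (c k) (d k))
      (Set.Ioo (a l) (b l) ×ˢ Set.Ioo (c l) (d l))) :
    ∑ k ∈ Y, |rectDiff f (a k) (b k) (c k) (d k)| ≤ L Y.card * V := by
  let e := Y.equivFin.symm
  have hfam : IsRectFamily (fun k => a (e k)) (fun k => b (e k)) (fun k => c (e k))
      (fun k => d (e k)) := by
    refine ⟨fun k => hmem _ (e k).2, fun k l hkl => hdisj _ (e k).2 _ (e l).2 fun h => hkl ?_⟩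
    exact e.injective (Subtype.ext h)
  refine sum_le_mul_of_sum_div_le hL hL0 hL1 Y (fun _ => abs_nonneg _) ?_
  rw [← ENNReal.ofReal_le_ofReal_iff hV0]
  refine le_trans ?_ hV
  unfold VStar
  exact le_iSup_of_le _ (le_iSup_of_le _ (le_iSup_of_le _ (le_iSup_of_le _ (le_iSup_of_le _
    (le_iSup_of_le hfam le_rfl)))))

lemma sum_abs_sub_le {L : ℕ → ℝ} (hL : Monotone L) (hL0 : 0 ≤ L 0)
    (hL1 : ∀ k, 0 < L (k + 1)) {f : ℝ × ℝ → ℝ} {V : ℝ} (hV0 : 0 ≤ V)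
    (hV : V2 L f ≤ ENNReal.ofReal V) {x : ℝ} (hx : x ∈ I) {ι : Type*} (Y : Finset ι)
    {c d : ι → ℝ} (hmem : ∀ k ∈ Y, c k ∈ I ∧ d k ∈ I ∧ c k < d k)
    (hdisj : ∀ k ∈ Y, ∀ l ∈ Y, k ≠ l → Disjoint (Set.Ioo (c k) (d k)) (Set.Ioo (c l) (d l))) :
    ∑ k ∈ Y, |f (x, d k) - f (x, c k)| ≤ L Y.card * V := by
  let e := Y.equivFin.symm
  have hfam : IsIntervalFamily (fun k => c (e k)) (fun k => d (e k)) := by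
    refine ⟨fun k => hmem _ (e k).2, fun k l hkl => hdisj _ (e k).2 _ (e l).2 fun h => hkl ?_⟩
    exact e.injective (Subtype.ext h)
  refine sum_le_mul_of_sum_div_le hL hL0 hL1 Y (g := fun k => |f (x, d k) - f (x, c k)|)
    (fun _ => abs_nonneg _) ?_
  rw [← ENNReal.ofReal_le_ofReal_iff hV0]
  refine le_trans ?_ hV
  unfold V2
  exact le_iSup_of_le x (le_iSup_of_le hx (le_iSup_of_le _ (le_iSup_of_le _ (le_iSup_of_le _
    (le_iSup_of_le hfam le_rfl)))))

/-- Lets the estimates in the second variable serve for the first. -/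
lemma V1_eq_V2_swap (L : ℕ → ℝ) (f : ℝ × ℝ → ℝ) : V1 L f = V2 L (f ∘ Prod.swap) := rfl

lemma abs_sub_le_of_V2_le {L : ℕ → ℝ} (hL : Monotone L) (hL0 : 0 ≤ L 0)
    (hL1 : ∀ k, 0 < L (k + 1)) {f : ℝ × ℝ → ℝ} {V : ℝ} (hV0 : 0 ≤ V)
    (hV : V2 L f ≤ ENNReal.ofReal V) {x t t' : ℝ} (hx : x ∈ I) (ht : t ∈ I) (ht' : t' ∈ I) :
    |f (x, t) - f (x, t')| ≤ L 1 * V := by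
  have key : ∀ u ∈ I, ∀ v ∈ I, u < v → |f (x, v) - f (x, u)| ≤ L 1 * V := by
    intro u hu v hv huv
    have := sum_abs_sub_le hL hL0 hL1 hV0 hV hx ({()} : Finset Unit) (c := fun _ => u)
      (d := fun _ => v) (fun _ _ => ⟨hu, hv, huv⟩) (fun _ _ _ _ h => absurd rfl h)
    simpa using this
  rcases lt_trichotomy t t' with h | h | h
  · rw [abs_sub_comm]
    exact key t ht t' ht' h
  · rw [h, sub_self, abs_zero]
    exact mul_nonneg (hL0.trans (hL (Nat.zero_le _))) hV0
  · exact key t' ht' t ht h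

/-! ### Integrals against kernels that are odd on dyadic intervals -/

lemma gridPoint_lt {M c c' : ℕ} (hM : 0 < M) (h : c < c') (τ : ℝ) :
    gridPoint M c τ < gridPoint M c' τ := by
  have hM0 : (0 : ℝ) < M := by exact_mod_cast hM
  have : (c : ℝ) / M < c' / M := by
    rw [div_lt_div_iff_of_pos_right hM0]
    exact_mod_cast h
  unfold gridPoint
  linarith

lemma gridPoint_le {c c' : ℕ} (M : ℕ) (h : c ≤ c') (τ : ℝ) :
    gridPoint M c τ ≤ gridPoint M c' τ := by
  unfold gridPoint
  gcongr

lemma disjoint_Ioo_gridPoint (M : ℕ) {e e' : ℕ} (h : e ≠ e') (τ : ℝ) :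
    Disjoint (Set.Ioo (gridPoint M (2 * e) τ) (gridPoint M (2 * e + 1) τ))
      (Set.Ioo (gridPoint M (2 * e') τ) (gridPoint M (2 * e' + 1) τ)) := by
  refine Set.disjoint_left.2 fun s hs hs' => ?_
  rcases lt_or_gt_of_ne h with h | h
  · have := gridPoint_le M (show 2 * e + 1 ≤ 2 * e' by omega) τ
    linarith [hs.2, hs'.1]
  · have := gridPoint_le M (show 2 * e' + 1 ≤ 2 * e by omega) τ
    linarith [hs.1, hs'.2]

lemma cell_gridPoint (q c : ℕ) {τ : ℝ} (hτ : τ ∈ Set.Ico (0 : ℝ) (1 / (2 ^ q : ℕ))) :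
    cell q (gridPoint (2 ^ q) c τ) = c := by
  push_cast at hτ
  have := cell_tile q c hτ
  unfold gridPoint
  push_cast
  exact this

lemma sum_range_two_pow_succ (q : ℕ) (g : ℕ → ℝ) :
    ∑ c ∈ Finset.range (2 ^ (q + 1)), g c =
      ∑ e ∈ Finset.range (2 ^ q), (g (2 * e) + g (2 * e + 1)) := by
  have key : ∀ n, ∑ c ∈ Finset.range (2 * n), g c =
      ∑ e ∈ Finset.range n, (g (2 * e) + g (2 * e + 1)) := by
    intro n
    induction n with
    | zero => simp
    | succ n ih =>
      rw [mul_add, mul_one, Finset.sum_range_succ, Finset.sum_range_succ, ih,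
        Finset.sum_range_succ, add_assoc]
  rw [pow_succ', key]

/-- `u` is bounded by `U`, changes sign between the halves of each dyadic interval of length
`2⁻ᵠ`, and vanishes on the intervals whose index is not in `X`. -/
structure IsHaarPiece (q : ℕ) (X : Finset ℕ) (U : ℝ) (u : ℝ → ℝ) : Prop where
  measurable : Measurable u
  subset : X ⊆ Finset.range (2 ^ q)
  nonneg : 0 ≤ U
  bound : ∀ s ∈ I, |u s| ≤ U
  anti : ∀ e < 2 ^ q, ∀ τ ∈ Set.Ico (0 : ℝ) (1 / (2 ^ (q + 1) : ℕ)),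
    u (gridPoint (2 ^ (q + 1)) (2 * e + 1) τ) = -u (gridPoint (2 ^ (q + 1)) (2 * e) τ)
  zero : ∀ e < 2 ^ q, ∀ τ ∈ Set.Ico (0 : ℝ) (1 / (2 ^ (q + 1) : ℕ)), e ∉ X →
    u (gridPoint (2 ^ (q + 1)) (2 * e) τ) = 0

lemma integrableOn_mul_mul {f : ℝ × ℝ → ℝ} (hf : IntegrableOn f I2) {u v : ℝ → ℝ}
    (hu : Measurable u) (hv : Measurable v) {U U' : ℝ} (hU : ∀ s ∈ I, |u s| ≤ U)
    (hU' : ∀ s ∈ I, |v s| ≤ U') : IntegrableOn (fun p => f p * (u p.1 * v p.2)) I2 := by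
  refine Integrable.mono' (hf.norm.const_mul (U * U')) ?_ ?_
  · exact hf.1.mul ((hu.comp measurable_fst).mul (hv.comp measurable_snd)).aestronglyMeasurable
  · refine ae_restrict_of_forall_mem measurableSet_I2 fun p hp => ?_
    rw [norm_mul, mul_comm, Real.norm_eq_abs (u p.1 * v p.2), abs_mul]
    have h1 := hU _ hp.1
    have h2 := hU' _ hp.2
    have h3 := (abs_nonneg _).trans h1
    gcongr

/-- Oddness in both variables turns the values at the four corners into one mixed difference. -/
lemma sum_mul_sum_eq_rectDiff {f : ℝ × ℝ → ℝ} {u v : ℝ → ℝ} {a b c d : ℝ} (hu : u b = -u a)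
    (hv : v d = -v c) :
    (f (a, c) * (u a * v c) + f (a, d) * (u a * v d)) +
      (f (b, c) * (u b * v c) + f (b, d) * (u b * v d)) = u a * v c * rectDiff f a b c d := by
  rw [hu, hv, rectDiff]
  ring

/-- On each translated grid the points pair up across the halves of the dyadic intervals. The sum
becomes one over mixed differences on disjoint rectangles, one for each pair of cells in `X ×ˢ X'`.
-/
lemma abs_integral_haar_haar_le {L : ℕ → ℝ} (hL : Monotone L) (hL0 : 0 ≤ L 0)
    (hL1 : ∀ k, 0 < L (k + 1)) {f : ℝ × ℝ → ℝ} {V : ℝ} (hV0 : 0 ≤ V)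
    (hV : VStar L f ≤ ENNReal.ofReal V) (hf : IntegrableOn f I2) {q q' : ℕ} {X X' : Finset ℕ}
    {U U' : ℝ} {u v : ℝ → ℝ} (hu : IsHaarPiece q X U u) (hv : IsHaarPiece q' X' U' v) :
    |∫ p in I2, f p * (u p.1 * v p.2)| ≤
      U * U' * (L (X.card * X'.card) * V) / ((2 ^ (q + 1) : ℕ) * (2 ^ (q' + 1) : ℕ)) := by
  refine abs_integral_I2_le_of_tile (by positivity) (by positivity)
    (integrableOn_mul_mul hf hu.measurable hv.measurable hu.bound hv.bound) fun τ hτ τ' hτ' => ?_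
  set M := 2 ^ (q + 1) with hM
  set N := 2 ^ (q' + 1) with hN
  have hM0 : 0 < M := by positivity
  have hN0 : 0 < N := by positivity
  let R : ℕ → ℕ → ℝ := fun e e' => rectDiff f (gridPoint M (2 * e) τ) (gridPoint M (2 * e + 1) τ)
    (gridPoint N (2 * e') τ') (gridPoint N (2 * e' + 1) τ')
  have hmemM : ∀ e < 2 ^ q, gridPoint M (2 * e) τ ∈ I ∧ gridPoint M (2 * e + 1) τ ∈ I :=
    fun e he => ⟨gridPoint_mem_I (by omega) hτ, gridPoint_mem_I (by omega) hτ⟩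
  have hmemN : ∀ e < 2 ^ q', gridPoint N (2 * e) τ' ∈ I ∧ gridPoint N (2 * e + 1) τ' ∈ I :=
    fun e he => ⟨gridPoint_mem_I (by omega) hτ', gridPoint_mem_I (by omega) hτ'⟩
  have h1 : ∑ c ∈ Finset.range M, ∑ c' ∈ Finset.range N,
      f (gridPoint M c τ, gridPoint N c' τ') * (u (gridPoint M c τ) * v (gridPoint N c' τ')) =
      ∑ e ∈ X, ∑ e' ∈ X',
        u (gridPoint M (2 * e) τ) * v (gridPoint N (2 * e') τ') * R e e' := by
    have h2 : ∑ c ∈ Finset.range M, ∑ c' ∈ Finset.range N,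
        f (gridPoint M c τ, gridPoint N c' τ') * (u (gridPoint M c τ) * v (gridPoint N c' τ')) =
        ∑ e ∈ Finset.range (2 ^ q), ∑ e' ∈ Finset.range (2 ^ q'),
        u (gridPoint M (2 * e) τ) * v (gridPoint N (2 * e') τ') * R e e' := by
      rw [sum_range_two_pow_succ]
      refine Finset.sum_congr rfl fun e he => ?_
      rw [sum_range_two_pow_succ, sum_range_two_pow_succ, ← Finset.sum_add_distrib]
      refine Finset.sum_congr rfl fun e' he' => ?_
      exact sum_mul_sum_eq_rectDiff (hu.anti e (Finset.mem_range.1 he) τ hτ)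
        (hv.anti e' (Finset.mem_range.1 he') τ' hτ')
    rw [h2]
    symm
    rw [Finset.sum_congr rfl fun e _ => Finset.sum_subset hv.subset fun e' he' hX' => by
      rw [hv.zero e' (Finset.mem_range.1 he') τ' hτ' hX', mul_zero, zero_mul]]
    refine Finset.sum_subset hu.subset fun e he hX => Finset.sum_eq_zero fun e' _ => ?_
    rw [hu.zero e (Finset.mem_range.1 he) τ hτ hX, zero_mul, zero_mul]
  have hX : ∀ k ∈ X ×ˢ X', k.1 < 2 ^ q ∧ k.2 < 2 ^ q' := fun k hk =>
    ⟨Finset.mem_range.1 (hu.subset (Finset.mem_product.1 hk).1),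
      Finset.mem_range.1 (hv.subset (Finset.mem_product.1 hk).2)⟩
  have h3 : ∑ k ∈ X ×ˢ X', |R k.1 k.2| ≤ L (X ×ˢ X').card * V := by
    refine sum_abs_rectDiff_le hL hL0 hL1 hV0 hV (X ×ˢ X')
      (a := fun k => gridPoint M (2 * k.1) τ) (b := fun k => gridPoint M (2 * k.1 + 1) τ)
      (c := fun k => gridPoint N (2 * k.2) τ') (d := fun k => gridPoint N (2 * k.2 + 1) τ')
      (fun k hk => ?_) (fun k _ l _ hkl => ?_)
    · obtain ⟨hk1, hk2⟩ := hX k hk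
      exact ⟨(hmemM _ hk1).1, (hmemM _ hk1).2, (hmemN _ hk2).1, (hmemN _ hk2).2,
        gridPoint_lt hM0 (by omega) τ, gridPoint_lt hN0 (by omega) τ'⟩
    · rw [Set.disjoint_prod]
      by_cases h : k.1 = l.1
      · exact Or.inr (disjoint_Ioo_gridPoint N (fun h' => hkl (Prod.ext h h')) τ')
      · exact Or.inl (disjoint_Ioo_gridPoint M h τ)
  rw [Finset.card_product] at h3
  rw [h1, ← Finset.sum_product']
  refine (Finset.abs_sum_le_sum_abs _ _).trans ?_
  refine le_trans ?_ (mul_le_mul_of_nonneg_left h3 (mul_nonneg hu.nonneg hv.nonneg))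
  rw [Finset.mul_sum]
  refine Finset.sum_le_sum fun k hk => ?_
  obtain ⟨hk1, hk2⟩ := hX k hk
  rw [abs_mul, abs_mul]
  have b1 := hu.bound _ (hmemM _ hk1).1
  have b2 := hv.bound _ (hmemN _ hk2).1
  have := hu.nonneg
  gcongr

/-- The Walsh–Dirichlet kernel of order `2ᵖ` at `x`. -/
noncomputable def dyadicKernel (x : ℝ) (p : ℕ) (s : ℝ) : ℝ :=
  if cell p s = cell p x then 2 ^ p else 0

lemma measurable_dyadicKernel (x : ℝ) (p : ℕ) : Measurable (dyadicKernel x p) :=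
  Measurable.ite (measurableSet_cell_eq p _) measurable_const measurable_const

lemma abs_dyadicKernel_le (x : ℝ) (p : ℕ) (s : ℝ) : |dyadicKernel x p s| ≤ 2 ^ p := by
  unfold dyadicKernel
  split_ifs
  · rw [abs_of_nonneg (by positivity)]
  · rw [abs_zero]; positivity

/-- On each translated grid the Dirichlet kernel sees a single abscissa, so only the variation of
`f` along one vertical line enters. -/
lemma abs_integral_dyadic_haar_le {L : ℕ → ℝ} (hL : Monotone L) (hL0 : 0 ≤ L 0)
    (hL1 : ∀ k, 0 < L (k + 1)) {f : ℝ × ℝ → ℝ} {V : ℝ} (hV0 : 0 ≤ V)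
    (hV : V2 L f ≤ ENNReal.ofReal V) (hf : IntegrableOn f I2) {x : ℝ} (hx : x ∈ I) {p q' : ℕ}
    {X' : Finset ℕ} {U' : ℝ} {v : ℝ → ℝ} (hv : IsHaarPiece q' X' U' v) :
    |∫ s in I2, f s * (dyadicKernel x p s.1 * v s.2)| ≤
      U' * (L X'.card * V) / (2 ^ (q' + 1) : ℕ) := by
  have hp0 : (0 : ℝ) < 2 ^ p := by positivity
  -- The height 2^p of the Dirichlet kernel is exactly compensated by the mesh in the first
  -- variable.
  have e : U' * (L X'.card * V) / (2 ^ (q' + 1) : ℕ) =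
      2 ^ p * (U' * (L X'.card * V)) / ((2 ^ p : ℕ) * (2 ^ (q' + 1) : ℕ)) := by
    push_cast
    field_simp
  rw [e]
  refine abs_integral_I2_le_of_tile (by positivity) (by positivity)
    (integrableOn_mul_mul hf (measurable_dyadicKernel x p) hv.measurable
      (fun s _ => abs_dyadicKernel_le x p s) hv.bound) fun τ hτ τ' hτ' => ?_
  set N := 2 ^ (q' + 1) with hN
  have hN0 : 0 < N := by positivity
  have hmemN : ∀ e < 2 ^ q', gridPoint N (2 * e) τ' ∈ I ∧ gridPoint N (2 * e + 1) τ' ∈ I :=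
    fun e he => ⟨gridPoint_mem_I (by omega) hτ', gridPoint_mem_I (by omega) hτ'⟩
  have hX : ∀ k ∈ X', k < 2 ^ q' := fun k hk => Finset.mem_range.1 (hv.subset hk)
  set s := gridPoint (2 ^ p) (cell p x) τ with hs
  have hsI : s ∈ I := gridPoint_mem_I (cell_lt hx p) hτ
  have h1 : ∑ c ∈ Finset.range (2 ^ p), ∑ c' ∈ Finset.range N,
      f (gridPoint (2 ^ p) c τ, gridPoint N c' τ') *
        (dyadicKernel x p (gridPoint (2 ^ p) c τ) * v (gridPoint N c' τ')) =
      ∑ e ∈ X', -(2 ^ p * v (gridPoint N (2 * e) τ') *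
        (f (s, gridPoint N (2 * e + 1) τ') - f (s, gridPoint N (2 * e) τ'))) := by
    rw [Finset.sum_eq_single (cell p x)]
    · rw [sum_range_two_pow_succ, dyadicKernel, cell_gridPoint p _ hτ, if_pos rfl]
      symm
      rw [Finset.sum_subset hv.subset fun e he hX' => by
        rw [hv.zero e (Finset.mem_range.1 he) τ' hτ' hX', mul_zero, zero_mul, neg_zero]]
      refine Finset.sum_congr rfl fun e he => ?_
      rw [hv.anti e (Finset.mem_range.1 he) τ' hτ']
      ring
    · intro c _ hc
      refine Finset.sum_eq_zero fun c' _ => ?_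
      rw [dyadicKernel, cell_gridPoint p _ hτ, if_neg hc, zero_mul, mul_zero]
    · intro h
      exact absurd (Finset.mem_range.2 (cell_lt hx p)) h
  have h3 : ∑ k ∈ X', |f (s, gridPoint N (2 * k + 1) τ') - f (s, gridPoint N (2 * k) τ')| ≤
      L X'.card * V :=
    sum_abs_sub_le hL hL0 hL1 hV0 hV hsI X' (c := fun k => gridPoint N (2 * k) τ')
      (d := fun k => gridPoint N (2 * k + 1) τ')
      (fun k hk => ⟨(hmemN _ (hX k hk)).1, (hmemN _ (hX k hk)).2,
        gridPoint_lt hN0 (by omega) τ'⟩)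
      (fun k _ l _ hkl => disjoint_Ioo_gridPoint N hkl τ')
  rw [h1]
  refine (Finset.abs_sum_le_sum_abs _ _).trans ?_
  refine le_trans ?_ (mul_le_mul_of_nonneg_left (mul_le_mul_of_nonneg_left h3 hv.nonneg) hp0.le)
  rw [Finset.mul_sum, Finset.mul_sum]
  refine Finset.sum_le_sum fun k hk => ?_
  rw [abs_neg, abs_mul, abs_mul, abs_of_pos hp0, mul_assoc]
  have b2 := hv.bound _ (hmemN _ (hX k hk)).1
  gcongr

lemma integral_I2_mul (u v : ℝ → ℝ) :
    ∫ p in I2, u p.1 * v p.2 = (∫ s in I, u s) * ∫ t in I, v t :=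
  setIntegral_prod_mul u v I I

lemma integrableOn_const_I2 (z : ℝ) : IntegrableOn (fun _ => z) I2 := by
  refine integrableOn_const ?_
  rw [I2, Measure.volume_eq_prod, Measure.prod_prod]
  simp [I]

/-- The two halves of each cell cancel on every translated grid. -/
lemma IsHaarPiece.integral_eq_zero {q : ℕ} {X : Finset ℕ} {U : ℝ} {u : ℝ → ℝ}
    (hu : IsHaarPiece q X U u) : ∫ s in I, u s = 0 := by
  have h1 : |∫ p in I2, u p.1 * (fun _ => (1 : ℝ)) p.2| ≤
      0 / ((2 ^ (q + 1) : ℕ) * (1 : ℕ)) := by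
    have hint : IntegrableOn (fun p : ℝ × ℝ => u p.1 * (fun _ => (1 : ℝ)) p.2) I2 := by
      simpa using integrableOn_mul_mul (integrableOn_const_I2 1) hu.measurable
        (measurable_const (a := (1 : ℝ))) hu.bound (U' := 1) (by simp)
    -- A grid with one point in the second variable makes the planar estimate serve for an integral
    -- in one variable.
    refine abs_integral_I2_le_of_tile (by positivity) one_pos hint fun τ hτ τ' _ => ?_
    rw [sum_range_two_pow_succ, Finset.sum_eq_zero, abs_zero]
    intro e he
    simp [hu.anti e (Finset.mem_range.1 he) τ hτ]
  rw [integral_I2_mul u (fun _ => 1), zero_div, abs_nonpos_iff] at h1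
  simpa [I] using h1

lemma integral_mul_swap (f : ℝ × ℝ → ℝ) (u v : ℝ → ℝ) :
    ∫ p in I2, f p * (u p.1 * v p.2) = ∫ p in I2, (f ∘ Prod.swap) p * (v p.1 * u p.2) := by
  have := setIntegral_prod_swap (μ := volume) (ν := volume) I I
    (fun p : ℝ × ℝ => f p * (u p.1 * v p.2))
  rw [I2, Measure.volume_eq_prod, ← this]
  simp only [Function.comp, Prod.fst_swap, Prod.snd_swap, mul_comm (u _)]

/-! ### The pieces of the Cesàro kernel -/

/-- The restriction of a dyadic block of the kernel to a dyadic shell. -/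
noncomputable def shellKernel (α : ℝ) (n : ℕ) (x : ℝ) (q d : ℕ) : ℝ → ℝ :=
  (shell x q d).indicator (blockKernel α n x q)

/-- The indices of the dyadic intervals of length `2⁻ᵠ` in that of length `2⁻⁽ᵠ⁻ᵈ⁾` at `x`. -/
noncomputable def shellCells (x : ℝ) (q d : ℕ) : Finset ℕ :=
  (Finset.range (2 ^ q)).filter fun e => e / 2 ^ d = cell (q - d) x

lemma card_shellCells_le (x : ℝ) (q d : ℕ) : (shellCells x q d).card ≤ 2 ^ d := by
  have hsub : shellCells x q d ⊆
      Finset.Ico (2 ^ d * cell (q - d) x) (2 ^ d * cell (q - d) x + 2 ^ d) := by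
    intro e he
    have h := (Finset.mem_filter.1 he).2
    have h1 := Nat.div_add_mod e (2 ^ d)
    have h2 := Nat.mod_lt e (show 0 < 2 ^ d by positivity)
    rw [h] at h1
    rw [Finset.mem_Ico]
    omega
  simpa using Finset.card_le_card hsub

lemma mem_shell_congr {x s t : ℝ} {q d : ℕ} (h : cell q s = cell q t) (hd : d ≤ q) :
    s ∈ shell x q d ↔ t ∈ shell x q d := by
  have h1 := cell_mono_eq (Nat.sub_le q d) h
  unfold shell
  rw [Set.mem_ofPred_eq, Set.mem_ofPred_eq, h1]
  -- For d = 0 the level q - d + 1 exceeds q, but then the second condition of the shell is vacuous.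
  by_cases hd0 : d = 0
  · simp [hd0]
  · rw [cell_mono_eq (show q - d + 1 ≤ q by omega) h]

/-- Every frequency of the block is 2^q + r with r < 2^q: it contains r_q, and w_r does not
distinguish the halves of a cell of level q. -/
lemma blockKernel_eq_neg {α : ℝ} {n q : ℕ} {x s t : ℝ} (hs : 0 ≤ s) (ht : 0 ≤ t)
    (h : cell q s = cell q t) (hr : rademacher q t = -rademacher q s) :
    blockKernel α n x q t = -blockKernel α n x q s := by
  unfold blockKernel
  rw [← Finset.sum_neg_distrib]
  refine Finset.sum_congr rfl fun r hr' => ?_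
  have hr2 : r < 2 ^ q := (Finset.mem_range.1 hr').trans_le (blockLen_le n q)
  rw [walshPair, walshPair, walsh_two_pow_add hr2 s, walsh_two_pow_add hr2 t, hr,
    walsh_congr hs ht hr2 h]
  ring

/-- A shell is a union of cells of level q, so restricting to it preserves the oddness of the block.
-/
lemma isHaarPiece_shellKernel {α : ℝ} (hα : α ∈ Set.Ioo (0 : ℝ) 1) {n q d : ℕ} (hn : n ≠ 0)
    (hq : q ≤ Nat.log 2 n) (hd : d ≤ q) {x : ℝ} (hx : x ∈ I) :
    IsHaarPiece q (shellCells x q d)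
      (kernelConst α * (2 ^ q / 2 ^ Nat.log 2 n) * 2 ^ q * ((2 : ℝ) ^ d) ^ (α - 1))
      (shellKernel α n x q d) := by
  have hU : 0 ≤ kernelConst α * (2 ^ q / 2 ^ Nat.log 2 n) * 2 ^ q * ((2 : ℝ) ^ d) ^ (α - 1) := by
    have := kernelConst_pos hα
    positivity
  have hc : ∀ e < 2 ^ q, ∀ τ ∈ Set.Ico (0 : ℝ) (1 / (2 ^ (q + 1) : ℕ)),
      cell q (gridPoint (2 ^ (q + 1)) (2 * e) τ) = e ∧
      cell q (gridPoint (2 ^ (q + 1)) (2 * e + 1) τ) = e := by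
    intro e _ τ hτ
    have h1 := cell_add_div q 1 (gridPoint (2 ^ (q + 1)) (2 * e) τ)
    have h2 := cell_add_div q 1 (gridPoint (2 ^ (q + 1)) (2 * e + 1) τ)
    rw [cell_gridPoint _ _ hτ] at h1 h2
    omega
  refine ⟨(measurable_blockKernel α n x q).indicator (measurableSet_shell x q d),
    Finset.filter_subset _ _, hU, fun s hs => ?_, fun e he τ hτ => ?_, fun e he τ hτ heX => ?_⟩
  · unfold shellKernel
    by_cases h : s ∈ shell x q d
    · rw [Set.indicator_of_mem h]
      exact abs_blockKernel_le_of_mem_shell hα hn hq hd hx hs h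
    · rw [Set.indicator_of_notMem h, abs_zero]
      exact hU
  · have hs := (gridPoint_mem_I (show 2 * e < 2 ^ (q + 1) by omega) hτ).1
    have ht := (gridPoint_mem_I (show 2 * e + 1 < 2 ^ (q + 1) by omega) hτ).1
    obtain ⟨h1, h2⟩ := hc e he τ hτ
    have h3 := h1.trans h2.symm
    have h4 : rademacher q (gridPoint (2 ^ (q + 1)) (2 * e + 1) τ) =
        -rademacher q (gridPoint (2 ^ (q + 1)) (2 * e) τ) := by
      rw [rademacher_eq hs, rademacher_eq ht, digit_eq_cell, digit_eq_cell, cell_gridPoint _ _ hτ,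
        cell_gridPoint _ _ hτ, if_neg (by omega), if_pos (by omega)]
    unfold shellKernel
    by_cases h : gridPoint (2 ^ (q + 1)) (2 * e) τ ∈ shell x q d
    · rw [Set.indicator_of_mem h, Set.indicator_of_mem ((mem_shell_congr h3 hd).1 h)]
      exact blockKernel_eq_neg hs ht h3 h4
    · rw [Set.indicator_of_notMem h,
        Set.indicator_of_notMem fun h' => h ((mem_shell_congr h3 hd).2 h'), neg_zero]
  · unfold shellKernel
    rw [Set.indicator_of_notMem]
    intro h
    refine heX (Finset.mem_filter.2 ⟨Finset.mem_range.2 he, ?_⟩)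
    rw [← h.1, ← cell_sub_div hd, (hc e he τ hτ).1]

/-! ### Dyadic addition -/

lemma val_digits_two (x : ℝ) (k : ℕ) : (Real.digits x 2 k : ℕ) = digit x k := by
  simp [Real.digits, digit, Fin.ofNat, mul_comm]

/-- The points whose dyadic digits are eventually complementary to those of `x`. -/
def complementary (x : ℝ) : Set ℝ := {s | s ∈ I ∧ ∃ K, ∀ k ≥ K, digit x k ≠ digit s k}

lemma digit_lt_two (x : ℝ) (k : ℕ) : digit x k < 2 := Nat.mod_lt _ two_pos

/-- Such a point is determined by a level K and its first K digits. These points are excluded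
because the digitwise sum with x then ends in ones, which is not a canonical expansion, and adding x
again need not return to the point. -/
lemma countable_complementary (x : ℝ) : (complementary x).Countable := by
  let C : ℕ → ℝ := fun K => Real.ofDigits (fun i => 1 - Real.digits x 2 (i + K))
  refine (Set.countable_range fun p : ℕ × ℕ =>
    ((2 : ℝ) ^ p.1)⁻¹ * p.2 + ((2 : ℝ) ^ p.1)⁻¹ * C p.1).mono ?_
  rintro s ⟨hs, K, hK⟩
  refine ⟨(K, cell K s), ?_⟩
  have h1 := Real.ofDigits_eq_sum_add_ofDigits (Real.digits s 2) K
  rw [Real.ofDigits_digits (by norm_num) hs] at h1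
  have h2 := Real.ofDigits_digits_sum_eq (b := 2) hs K
  have h3 : (fun i => Real.digits s 2 (i + K)) = fun i => 1 - Real.digits x 2 (i + K) := by
    funext i
    have h4 := hK (i + K) (by omega)
    rw [← val_digits_two, ← val_digits_two] at h4
    generalize Real.digits s 2 (i + K) = a at h4 ⊢
    generalize Real.digits x 2 (i + K) = b at h4 ⊢
    revert a b
    decide
  rw [h3] at h1
  push_cast at h1 h2
  have h5 : (2 : ℝ) ^ K ≠ 0 := by positivity
  conv_rhs => rw [h1]
  simp only [cell, ← h2, C]
  field_simp

lemma ofDigits_lt_one {E : ℕ → Fin 2} {k : ℕ} (h : E k = 0) : Real.ofDigits E < 1 := by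
  rw [← Real.ofDigits_const_last_eq_one 1]
  refine Summable.tsum_lt_tsum (i := k) (fun i => ?_) ?_ Real.summable_ofDigitsTerm
    Real.summable_ofDigitsTerm
  · simp only [Real.ofDigitsTerm]
    gcongr
    exact Fin.le_last _
  · simp [Real.ofDigitsTerm, h]

lemma exists_two_pow_mul_sum_ofDigitsTerm (E : ℕ → Fin 2) (k : ℕ) :
    ∃ m : ℕ, (2 : ℝ) ^ (k + 1) * ∑ i ∈ Finset.range (k + 1), Real.ofDigitsTerm E i = m ∧
      m % 2 = E k := by
  induction k with
  | zero =>
    refine ⟨E 0, ?_, Nat.mod_eq_of_lt (E 0).2⟩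
    simp [Real.ofDigitsTerm]
    ring
  | succ k ih =>
    obtain ⟨m, hm, -⟩ := ih
    refine ⟨2 * m + E (k + 1), ?_, ?_⟩
    · rw [Finset.sum_range_succ, mul_add, pow_succ', mul_assoc, hm, Real.ofDigitsTerm]
      push_cast
      field_simp
      ring
    · have := (E (k + 1)).2
      omega

/-- Infinitely many zeros make the remainder after k + 1 digits smaller than one, so that taking the
integral part produces no carry. -/
lemma digit_ofDigits {E : ℕ → Fin 2} (hE : ∀ K, ∃ k ≥ K, E k = 0) (k : ℕ) :
    digit (Real.ofDigits E) k = E k := by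
  obtain ⟨m, hm, hmod⟩ := exists_two_pow_mul_sum_ofDigitsTerm E k
  obtain ⟨l, hl, hl0⟩ := hE (k + 1)
  have h1 : Real.ofDigits (fun i => E (i + (k + 1))) < 1 := by
    refine ofDigits_lt_one (k := l - (k + 1)) ?_
    rwa [Nat.sub_add_cancel hl]
  have h0 := Real.ofDigits_nonneg (fun i => E (i + (k + 1)))
  have h2 : (2 : ℝ) ^ (k + 1) * Real.ofDigits E =
      m + Real.ofDigits (fun i => E (i + (k + 1))) := by
    rw [Real.ofDigits_eq_sum_add_ofDigits E (k + 1), mul_add, hm]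
    push_cast
    field_simp
  unfold digit
  rw [h2, show ⌊(m : ℝ) + Real.ofDigits (fun i => E (i + (k + 1)))⌋₊ = m from ?_, hmod]
  rw [Nat.floor_eq_iff (by positivity)]
  constructor <;> linarith

lemma tsum_digit {s : ℝ} (hs : s ∈ I) : ∑' k : ℕ, (digit s k : ℝ) / 2 ^ (k + 1) = s := by
  have h := Real.ofDigits_digits (b := 2) (by norm_num) hs
  conv_rhs => rw [← h]
  unfold Real.ofDigits
  refine tsum_congr fun k => ?_
  rw [Real.ofDigitsTerm, val_digits_two, div_eq_mul_inv]
  push_cast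
  rfl

/-- Off the exceptional set the digitwise sum has infinitely many zeros, so its digits are the
canonical ones and adding x twice is the identity digit by digit. If x and s agree in their first j
digits, those of the sum vanish. -/
lemma dyadicAdd_spec {x s : ℝ} (hs : s ∈ I) (hxs : s ∉ complementary x) :
    dyadicAdd x s ∈ I ∧ dyadicAdd x (dyadicAdd x s) = s ∧
      ∀ j, cell j s = cell j x → dyadicAdd x s ≤ (1 / 2) ^ j := by
  let E : ℕ → Fin 2 := fun k => if digit x k = digit s k then 0 else 1
  have hE : ∀ K, ∃ k ≥ K, E k = 0 := by
    intro K
    by_contra h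
    refine hxs ⟨hs, K, fun k hk h' => h ⟨k, hk, ?_⟩⟩
    simp [E, h']
  have habs : ∀ k, |(digit x k : ℝ) - digit s k| = ((E k : ℕ) : ℝ) := by
    intro k
    have h1 := digit_lt_two x k
    have h2 := digit_lt_two s k
    simp only [E]
    generalize digit x k = a at h1 ⊢
    generalize digit s k = b at h2 ⊢
    interval_cases a <;> interval_cases b <;> simp
  have hadd : dyadicAdd x s = Real.ofDigits E := by
    unfold dyadicAdd Real.ofDigits
    refine tsum_congr fun k => ?_
    rw [habs, Real.ofDigitsTerm, div_eq_mul_inv]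
    push_cast
    rfl
  refine ⟨?_, ?_, fun j hj => ?_⟩
  · rw [hadd]
    obtain ⟨k, -, hk⟩ := hE 0
    exact ⟨Real.ofDigits_nonneg _, ofDigits_lt_one hk⟩
  · conv_rhs => rw [← tsum_digit hs]
    rw [hadd]
    unfold dyadicAdd
    refine tsum_congr fun k => ?_
    rw [digit_ofDigits hE]
    congr 1
    have h1 := digit_lt_two x k
    have h2 := digit_lt_two s k
    simp only [E]
    generalize digit x k = a at h1 ⊢
    generalize digit s k = b at h2 ⊢
    interval_cases a <;> interval_cases b <;> simp
  · have h := Real.abs_ofDigits_sub_ofDigits_le (x := E) (y := fun _ => 0) (n := j)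
      fun i hi => by simp [E, digit_congr hi hj]
    have h0 : Real.ofDigits (fun _ => (0 : Fin 2)) = 0 := by
      simp [Real.ofDigits, Real.ofDigitsTerm]
    rw [h0, sub_zero] at h
    rw [hadd]
    refine (le_abs_self _).trans (h.trans (le_of_eq ?_))
    push_cast
    rw [one_div, inv_pow]

/-! ### Localization at a point of dyadic continuity -/

/-- The increments h = x ∔ s and δ = y ∔ t are small and lead back to s and t. -/
lemma exists_level_of_dyadicContinuousAt {f : ℝ × ℝ → ℝ} {x y : ℝ}
    (hf : DyadicContinuousAt f x y) {ε : ℝ} (hε : 0 < ε) :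
    ∃ J, ∀ s ∈ I, ∀ t ∈ I, s ∉ complementary x → t ∉ complementary y →
      cell J s = cell J x → cell J t = cell J y → |f (s, t) - f (x, y)| ≤ ε := by
  obtain ⟨δ, hδ, h⟩ := Metric.tendsto_nhdsWithin_nhds.1 hf ε hε
  obtain ⟨J, hJ⟩ := exists_pow_lt_of_lt_one hδ (by norm_num : (1 / 2 : ℝ) < 1)
  refine ⟨J, fun s hs t ht hsx hty hs' ht' => ?_⟩
  obtain ⟨h1, h2, h3⟩ := dyadicAdd_spec hs hsx
  obtain ⟨k1, k2, k3⟩ := dyadicAdd_spec ht hty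
  have := h (x := (dyadicAdd x s, dyadicAdd y t)) ⟨h1, k1⟩ (by
    rw [Prod.dist_eq, Real.dist_eq, Real.dist_eq, sub_zero, sub_zero, abs_of_nonneg h1.1,
      abs_of_nonneg k1.1]
    exact max_lt ((h3 J hs').trans_lt hJ) ((k3 J ht').trans_lt hJ))
  simp only [h2, k2] at this
  exact this.le

lemma ae_notMem_complementary (x y : ℝ) :
    ∀ᵐ p : ℝ × ℝ, p.1 ∉ complementary x ∧ p.2 ∉ complementary y := by
  have h1 : ∀ᵐ s : ℝ, s ∉ complementary x := (countable_complementary x).ae_notMem volume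
  have h2 : ∀ᵐ s : ℝ, s ∉ complementary y := (countable_complementary y).ae_notMem volume
  rw [Measure.volume_eq_prod]
  exact (Measure.quasiMeasurePreserving_fst.ae h1).and (Measure.quasiMeasurePreserving_snd.ae h2)

lemma setOf_cell_eq {x : ℝ} (hx : x ∈ I) (j : ℕ) :
    {s | s ∈ I ∧ cell j s = cell j x} =
      Set.Ico ((cell j x : ℝ) / 2 ^ j) ((cell j x + 1 : ℝ) / 2 ^ j) := by
  have h0 : (0 : ℝ) < 2 ^ j := by positivity
  ext s
  constructor
  · rintro ⟨h1, h2⟩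
    exact (cell_eq_iff h1.1 _ _).1 h2
  · intro h
    have hs0 : 0 ≤ s := le_trans (by positivity) h.1
    refine ⟨⟨hs0, h.2.trans_le ?_⟩, (cell_eq_iff hs0 _ _).2 h⟩
    rw [div_le_one h0]
    exact_mod_cast cell_lt hx j

/-- Near a point of dyadic continuity, the integral of `f` against a product kernel is close to
that of the value of `f` at the point. -/
lemma abs_integral_sub_le_of_support {f : ℝ × ℝ → ℝ} (hf : IntegrableOn f I2) {x y : ℝ}
    (hx : x ∈ I) (hy : y ∈ I) {u v : ℝ → ℝ} (hu : Measurable u) (hv : Measurable v) {U U' : ℝ}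
    (hU : ∀ s ∈ I, |u s| ≤ U) (hU' : ∀ s ∈ I, |v s| ≤ U') {J j j' : ℕ} (hj : J ≤ j) (hj' : J ≤ j')
    (hu0 : ∀ s ∈ I, cell j s ≠ cell j x → u s = 0)
    (hv0 : ∀ s ∈ I, cell j' s ≠ cell j' y → v s = 0) {ε : ℝ}
    (hJ : ∀ s ∈ I, ∀ t ∈ I, s ∉ complementary x → t ∉ complementary y →
      cell J s = cell J x → cell J t = cell J y → |f (s, t) - f (x, y)| ≤ ε) :
    |(∫ p in I2, f p * (u p.1 * v p.2)) - f (x, y) * ((∫ s in I, u s) * ∫ t in I, v t)| ≤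
      ε * (U / 2 ^ j) * (U' / 2 ^ j') := by
  have hi1 := integrableOn_mul_mul hf hu hv hU hU'
  have hi2 := integrableOn_mul_mul (integrableOn_const_I2 (f (x, y))) hu hv hU hU'
  rw [← integral_I2_mul, ← integral_const_mul, ← integral_sub hi1 hi2]
  let S : Set (ℝ × ℝ) := {s | s ∈ I ∧ cell j s = cell j x} ×ˢ {t | t ∈ I ∧ cell j' t = cell j' y}
  have hSm : MeasurableSet S := by
    simp only [S, setOf_cell_eq hx, setOf_cell_eq hy]
    exact measurableSet_Ico.prod measurableSet_Ico
  have hSI : S ⊆ I2 := fun p hp => ⟨hp.1.1, hp.2.1⟩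
  have hvol : (volume : Measure (ℝ × ℝ)).real S = 1 / 2 ^ j * (1 / 2 ^ j') := by
    simp only [S, setOf_cell_eq hx, setOf_cell_eq hy]
    rw [Measure.volume_eq_prod, measureReal_prod_prod, Real.volume_real_Ico, Real.volume_real_Ico,
      ← sub_div, ← sub_div, add_sub_cancel_left, add_sub_cancel_left,
      max_eq_left (by positivity), max_eq_left (by positivity)]
  have hfin : (volume : Measure (ℝ × ℝ)) S < ∞ := by
    simp only [S, setOf_cell_eq hx, setOf_cell_eq hy]
    rw [Measure.volume_eq_prod, Measure.prod_prod]
    simp [ENNReal.mul_lt_top]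
  have hrestr : ∫ p in I2, (f p * (u p.1 * v p.2) - f (x, y) * (u p.1 * v p.2)) =
      ∫ p in S, (f p * (u p.1 * v p.2) - f (x, y) * (u p.1 * v p.2)) := by
    refine setIntegral_eq_of_subset_of_forall_sdiff_eq_zero measurableSet_I2 hSI ?_
    rintro p ⟨hp, hpS⟩
    by_cases h : cell j p.1 = cell j x
    · have h' : cell j' p.2 ≠ cell j' y := fun h' => hpS ⟨⟨hp.1, h⟩, ⟨hp.2, h'⟩⟩
      rw [hv0 _ hp.2 h']
      ring
    · rw [hu0 _ hp.1 h]
      ring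
  rw [hrestr, ← Real.norm_eq_abs, show ε * (U / 2 ^ j) * (U' / 2 ^ j') =
    ε * (U * U') * (1 / 2 ^ j * (1 / 2 ^ j')) by ring, ← hvol]
  -- The estimate `hJ` holds only off the exceptional sets, which are null.
  refine norm_setIntegral_le_of_norm_le_const_ae' hfin ?_
  filter_upwards [ae_notMem_complementary x y] with p hp hpS
  have h1 := hJ p.1 hpS.1.1 p.2 hpS.2.1 hp.1 hp.2 (cell_mono_eq hj hpS.1.2)
    (cell_mono_eq hj' hpS.2.2)
  rw [← sub_mul, norm_mul, Real.norm_eq_abs, Real.norm_eq_abs, abs_mul]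
  have h2 := hU _ hpS.1.1
  have h3 := hU' _ hpS.2.1
  have h4 := (abs_nonneg _).trans h1
  have h5 := (abs_nonneg _).trans h2
  gcongr

/-! ### The Cesàro mean as an integral -/

/-- The Walsh–Cesàro kernel of order `-α` at `x`. -/
noncomputable def cesaroKernel (α : ℝ) (n : ℕ) (x s : ℝ) : ℝ :=
  ∑ k ∈ Finset.range n, cesaroA (-α) (n - 1 - k) / cesaroA (-α) (n - 1) * walshPair x s k

/-- After interchanging the sums, `g k` is multiplied by the sum of A_r^{α-1} over r < n - k, which
is A_{n-1-k}^α. -/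
lemma sum_cesaroA_mul_sum (α : ℝ) (n : ℕ) (g : ℕ → ℝ) :
    ∑ i ∈ Finset.Icc 1 n, cesaroA (α - 1) (n - i) * ∑ k ∈ Finset.range i, g k =
      ∑ k ∈ Finset.range n, cesaroA α (n - 1 - k) * g k := by
  have h1 : ∑ i ∈ Finset.Icc 1 n, cesaroA (α - 1) (n - i) * ∑ k ∈ Finset.range i, g k =
      ∑ r ∈ Finset.range n, ∑ k ∈ Finset.range (n - r), cesaroA (α - 1) r * g k := by
    refine Finset.sum_nbij' (fun i => n - i) (fun r => n - r) ?_ ?_ ?_ ?_ ?_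
    · intro i hi
      have := Finset.mem_Icc.1 hi
      exact Finset.mem_range.2 (by omega)
    · intro r hr
      have := Finset.mem_range.1 hr
      exact Finset.mem_Icc.2 (by omega)
    · intro i hi
      exact Nat.sub_sub_self (Finset.mem_Icc.1 hi).2
    · intro r hr
      exact Nat.sub_sub_self (Finset.mem_range.1 hr).le
    · intro i hi
      rw [Nat.sub_sub_self (Finset.mem_Icc.1 hi).2, Finset.mul_sum]
  rw [h1, Finset.sum_comm' (t' := Finset.range n) (s' := fun k => Finset.range (n - k))]
  · refine Finset.sum_congr rfl fun k hk => ?_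
    have := Finset.mem_range.1 hk
    rw [← Finset.sum_mul, show n - k = n - 1 - k + 1 by omega, sum_cesaroA_sub_one]
  · intro r k
    simp only [Finset.mem_range]
    omega

lemma sum_sum_cesaroA_mul_partialSum (α β : ℝ) (f : ℝ × ℝ → ℝ) (n m : ℕ) (x y : ℝ) :
    ∑ i ∈ Finset.Icc 1 n, ∑ j ∈ Finset.Icc 1 m,
      cesaroA (α - 1) (n - i) * cesaroA (β - 1) (m - j) * partialSum f i j x y =
    ∑ k ∈ Finset.range n, ∑ l ∈ Finset.range m, cesaroA α (n - 1 - k) * cesaroA β (m - 1 - l) *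
      (coeff f k l * walsh k x * walsh l y) := by
  have h1 : ∀ i, ∑ j ∈ Finset.Icc 1 m,
      cesaroA (α - 1) (n - i) * cesaroA (β - 1) (m - j) * partialSum f i j x y =
      cesaroA (α - 1) (n - i) * ∑ k ∈ Finset.range i, ∑ l ∈ Finset.range m,
        cesaroA β (m - 1 - l) * (coeff f k l * walsh k x * walsh l y) := by
    intro i
    simp_rw [partialSum, mul_assoc (cesaroA (α - 1) (n - i))]
    rw [← Finset.mul_sum]
    congr 1
    simp_rw [Finset.mul_sum (Finset.range i)]
    rw [Finset.sum_comm]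
    exact Finset.sum_congr rfl fun k _ => sum_cesaroA_mul_sum β m _
  rw [Finset.sum_congr rfl fun i _ => h1 i, sum_cesaroA_mul_sum]
  simp_rw [Finset.mul_sum, mul_assoc]

lemma integral_sum_mul_sum {f : ℝ × ℝ → ℝ} (hf : IntegrableOn f I2) {ι κ : Type*} (A : Finset ι)
    (B : Finset κ) {u : ι → ℝ → ℝ} {v : κ → ℝ → ℝ} (hu : ∀ i, Measurable (u i))
    (hv : ∀ j, Measurable (v j)) (hU : ∀ i ∈ A, ∃ U, ∀ s ∈ I, |u i s| ≤ U)
    (hU' : ∀ j ∈ B, ∃ U, ∀ s ∈ I, |v j s| ≤ U) :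
    ∫ p in I2, f p * ((∑ i ∈ A, u i p.1) * ∑ j ∈ B, v j p.2) =
      ∑ i ∈ A, ∑ j ∈ B, ∫ p in I2, f p * (u i p.1 * v j p.2) := by
  have hint : ∀ i ∈ A, ∀ j ∈ B, IntegrableOn (fun p => f p * (u i p.1 * v j p.2)) I2 := by
    intro i hi j hj
    obtain ⟨U, h1⟩ := hU i hi
    obtain ⟨U', h2⟩ := hU' j hj
    exact integrableOn_mul_mul hf (hu i) (hv j) h1 h2
  simp_rw [Finset.sum_mul_sum, Finset.mul_sum]
  rw [integral_finsetSum _ fun i hi => integrable_finsetSum _ (hint i hi)]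
  exact Finset.sum_congr rfl fun i hi => integral_finsetSum _ (hint i hi)

lemma cesaroMean_eq_integral (α β : ℝ) {f : ℝ × ℝ → ℝ} (hf : IntegrableOn f I2) (n m : ℕ)
    (x y : ℝ) :
    cesaroMean (-α) (-β) f n m x y =
      ∫ p in I2, f p * (cesaroKernel α n x p.1 * cesaroKernel β m y p.2) := by
  unfold cesaroKernel
  rw [integral_sum_mul_sum hf (Finset.range n) (Finset.range m)
    (u := fun k s => cesaroA (-α) (n - 1 - k) / cesaroA (-α) (n - 1) * walshPair x s k)
    (v := fun l s => cesaroA (-β) (m - 1 - l) / cesaroA (-β) (m - 1) * walshPair y s l)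
    (fun k => (measurable_walshPair x k).const_mul _)
    (fun k => (measurable_walshPair y k).const_mul _)
    (fun k _ => ⟨|cesaroA (-α) (n - 1 - k) / cesaroA (-α) (n - 1)|, fun s _ => by
      rw [abs_mul, abs_walshPair, mul_one]⟩)
    (fun k _ => ⟨|cesaroA (-β) (m - 1 - k) / cesaroA (-β) (m - 1)|, fun s _ => by
      rw [abs_mul, abs_walshPair, mul_one]⟩)]
  rw [cesaroMean, sum_sum_cesaroA_mul_partialSum, Finset.mul_sum]
  refine Finset.sum_congr rfl fun k _ => ?_
  rw [Finset.mul_sum]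
  refine Finset.sum_congr rfl fun l _ => ?_
  rw [coeff, ← integral_mul_const, ← integral_mul_const, ← integral_const_mul,
    ← integral_const_mul]
  refine integral_congr_ae (Eventually.of_forall fun p => ?_)
  simp only [walshPair]
  ring

/-! ### Decomposition of the Cesàro kernel -/

/-- The `d`-th shell of the `i`-th dyadic block from the top of the kernel of order `n`. -/
noncomputable def kernelPiece (α : ℝ) (n : ℕ) (x : ℝ) (k : ℕ × ℕ) (s : ℝ) : ℝ :=
  if k.1 + k.2 ≤ Nat.log 2 n then shellKernel α n x (Nat.log 2 n - k.1) k.2 s else 0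

/-- The indices of the nonzero pieces of the kernel of order `n`. -/
def pieceIndex (n : ℕ) : Finset (ℕ × ℕ) :=
  Finset.range (Nat.log 2 n + 1) ×ˢ Finset.range (Nat.log 2 n + 1)

lemma kernelPiece_eq_zero_of_notMem (α : ℝ) (n : ℕ) (x : ℝ) {k : ℕ × ℕ} (hk : k ∉ pieceIndex n) :
    kernelPiece α n x k = 0 := by
  funext s
  unfold kernelPiece
  rw [if_neg, Pi.zero_apply]
  intro h
  refine hk (Finset.mem_product.2 ⟨Finset.mem_range.2 ?_, Finset.mem_range.2 ?_⟩) <;> omega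

lemma sum_shellKernel {α : ℝ} {n : ℕ} {x s : ℝ} (hx : x ∈ I) (hs : s ∈ I) (q : ℕ) :
    ∑ d ∈ Finset.range (q + 1), shellKernel α n x q d s = blockKernel α n x q s := by
  have h := sum_indicator_shell hx hs q
  conv_rhs => rw [← one_mul (blockKernel α n x q s), ← h, Finset.sum_mul]
  refine Finset.sum_congr rfl fun d _ => ?_
  unfold shellKernel
  by_cases hd : s ∈ shell x q d <;> simp [hd]

lemma cesaroKernel_eq {α : ℝ} (hα : α ∈ Set.Ioo (0 : ℝ) 1) {n : ℕ} (hn : n ≠ 0) {x s : ℝ}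
    (hx : x ∈ I) (hs : s ∈ I) :
    cesaroKernel α n x s =
      dyadicKernel x (Nat.log 2 n) s + ∑ k ∈ pieceIndex n, kernelPiece α n x k s := by
  set p := Nat.log 2 n with hp
  have hpn : 2 ^ p ≤ n := Nat.pow_log_le_self 2 hn
  have h1 : cesaroKernel α n x s = ∑ k ∈ Finset.range n, excess α n k * walshPair x s k +
      dyadicKernel x p s := by
    rw [dyadicKernel, ← dirichlet_two_pow hx hs p]
    have h2 : ∑ k ∈ Finset.range (2 ^ p), walshPair x s k =
        ∑ k ∈ Finset.range n, (if k < 2 ^ p then 1 else 0) * walshPair x s k := by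
      rw [← Finset.sum_subset (Finset.range_mono hpn)]
      · exact Finset.sum_congr rfl fun k hk => by rw [if_pos (Finset.mem_range.1 hk), one_mul]
      · intro k _ hk
        rw [if_neg (fun h => hk (Finset.mem_range.2 h)), zero_mul]
    rw [h2, ← Finset.sum_add_distrib]
    refine Finset.sum_congr rfl fun k _ => ?_
    unfold excess
    ring
  rw [h1, add_comm, sum_range_eq_sum_blocks hn, excess_zero hα, zero_mul, zero_add]
  congr 1
  -- Blocks are counted from the top one, so that pieces of the same index are comparable for
  -- different n; this allows n → ∞ with the index fixed.
  rw [pieceIndex, Finset.sum_product, ← hp, ← Finset.sum_range_reflect]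
  refine Finset.sum_congr rfl fun i hi => ?_
  have hi' := Finset.mem_range.1 hi
  rw [show p + 1 - 1 - i = p - i by omega]
  change blockKernel α n x (p - i) s = _
  rw [← sum_shellKernel hx hs]
  -- Pairs with i + d > p carry no piece; they enter with the value zero to make the index set a
  -- product.
  refine Eq.trans (Finset.sum_congr rfl fun d hd => ?_)
    (Finset.sum_subset (Finset.range_mono (by omega)) fun d _ hd => ?_)
  · have := Finset.mem_range.1 hd
    rw [kernelPiece, if_pos (show i + d ≤ Nat.log 2 n by omega)]
  · rw [Finset.mem_range] at hd
    rw [kernelPiece, if_neg (show ¬ (i + d ≤ Nat.log 2 n) by omega)]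

/-- The bound for the piece with index `k` of a kernel of order `-α` and degree about `2ᵖ`. -/
noncomputable def pieceBound (α : ℝ) (p : ℕ) (k : ℕ × ℕ) : ℝ :=
  kernelConst α * (1 / 2) ^ k.1 * 2 ^ (p - k.1) * ((2 : ℝ) ^ k.2) ^ (α - 1)

lemma isHaarPiece_kernelPiece {α : ℝ} (hα : α ∈ Set.Ioo (0 : ℝ) 1) {n : ℕ} (hn : n ≠ 0) {x : ℝ}
    (hx : x ∈ I) {k : ℕ × ℕ} (hk : k.1 + k.2 ≤ Nat.log 2 n) :
    IsHaarPiece (Nat.log 2 n - k.1) (shellCells x (Nat.log 2 n - k.1) k.2)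
      (pieceBound α (Nat.log 2 n) k) (kernelPiece α n x k) := by
  have h1 : kernelPiece α n x k = shellKernel α n x (Nat.log 2 n - k.1) k.2 := by
    funext s
    rw [kernelPiece, if_pos hk]
  have h2 : (2 : ℝ) ^ (Nat.log 2 n - k.1) / 2 ^ Nat.log 2 n = (1 / 2) ^ k.1 := by
    rw [pow_sub₀ _ (by norm_num) (by omega : k.1 ≤ Nat.log 2 n), one_div,
      inv_pow]
    field_simp
  have := isHaarPiece_shellKernel hα hn (Nat.sub_le (Nat.log 2 n) k.1)
    (show k.2 ≤ Nat.log 2 n - k.1 by omega) hx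
  rwa [h2, ← h1] at this

lemma measurable_kernelPiece (α : ℝ) (n : ℕ) (x : ℝ) (k : ℕ × ℕ) :
    Measurable (kernelPiece α n x k) := by
  unfold kernelPiece
  split_ifs
  · exact (measurable_blockKernel _ _ _ _).indicator (measurableSet_shell _ _ _)
  · exact measurable_const

lemma exists_bound_kernelPiece {α : ℝ} (hα : α ∈ Set.Ioo (0 : ℝ) 1) {n : ℕ} (hn : n ≠ 0) {x : ℝ}
    (hx : x ∈ I) (k : ℕ × ℕ) : ∃ U, ∀ s ∈ I, |kernelPiece α n x k s| ≤ U := by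
  by_cases hk : k.1 + k.2 ≤ Nat.log 2 n
  · exact ⟨_, (isHaarPiece_kernelPiece hα hn hx hk).bound⟩
  · exact ⟨0, fun s _ => by rw [kernelPiece, if_neg hk, abs_zero]⟩

lemma integral_cesaroKernel_eq {α β : ℝ} (hα : α ∈ Set.Ioo (0 : ℝ) 1)
    (hβ : β ∈ Set.Ioo (0 : ℝ) 1) {f : ℝ × ℝ → ℝ} (hf : IntegrableOn f I2) {n m : ℕ} (hn : n ≠ 0)
    (hm : m ≠ 0) {x y : ℝ} (hx : x ∈ I) (hy : y ∈ I) :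
    ∫ p in I2, f p * (cesaroKernel α n x p.1 * cesaroKernel β m y p.2) =
      (∫ p in I2, f p * (dyadicKernel x (Nat.log 2 n) p.1 * dyadicKernel y (Nat.log 2 m) p.2)) +
      (∑ k ∈ pieceIndex m,
        ∫ p in I2, f p * (dyadicKernel x (Nat.log 2 n) p.1 * kernelPiece β m y k p.2)) +
      ((∑ k ∈ pieceIndex n,
        ∫ p in I2, f p * (kernelPiece α n x k p.1 * dyadicKernel y (Nat.log 2 m) p.2)) +
      ∑ k ∈ pieceIndex n, ∑ l ∈ pieceIndex m,
        ∫ p in I2, f p * (kernelPiece α n x k p.1 * kernelPiece β m y l p.2)) := by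
  -- `none` stands for the Dirichlet kernel, so that one expansion of a product of sums gives all
  -- four parts.
  let u : Option (ℕ × ℕ) → ℝ → ℝ := fun o =>
    o.elim (dyadicKernel x (Nat.log 2 n)) (kernelPiece α n x)
  let v : Option (ℕ × ℕ) → ℝ → ℝ := fun o =>
    o.elim (dyadicKernel y (Nat.log 2 m)) (kernelPiece β m y)
  have h1 : ∫ p in I2, f p * (cesaroKernel α n x p.1 * cesaroKernel β m y p.2) =
      ∫ p in I2, f p * ((∑ o ∈ Finset.insertNone (pieceIndex n), u o p.1) *
        ∑ o ∈ Finset.insertNone (pieceIndex m), v o p.2) := by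
    refine setIntegral_congr_fun measurableSet_I2 fun p hp => ?_
    simp only [cesaroKernel_eq hα hn hx hp.1, cesaroKernel_eq hβ hm hy hp.2,
      Finset.sum_insertNone, u, v, Option.elim]
  rw [h1, integral_sum_mul_sum hf]
  · simp only [Finset.sum_insertNone, u, v, Option.elim]
    rw [Finset.sum_add_distrib]
  · rintro (_ | k)
    · exact measurable_dyadicKernel _ _
    · exact measurable_kernelPiece _ _ _ _
  · rintro (_ | k)
    · exact measurable_dyadicKernel _ _
    · exact measurable_kernelPiece _ _ _ _
  · rintro (_ | k) _
    · exact ⟨_, fun s _ => abs_dyadicKernel_le _ _ s⟩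
    · exact exists_bound_kernelPiece hα hn hx k
  · rintro (_ | k) _
    · exact ⟨_, fun s _ => abs_dyadicKernel_le _ _ s⟩
    · exact exists_bound_kernelPiece hβ hm hy k

/-! ### Kernels that concentrate at a point -/

/-- The kernels `u n` have integral `c` over `I`, live on shrinking dyadic intervals around `x`, and
are at most of the order of the reciprocal lengths of these. -/
def Concentrates (x : ℝ) (u : ℕ → ℝ → ℝ) (c : ℝ) : Prop :=
  ∃ C, 0 ≤ C ∧ ∀ J, ∀ᶠ n in atTop, Measurable (u n) ∧ ∫ s in I, u n s = c ∧
    ∃ j ≥ J, ∃ U, (∀ s ∈ I, |u n s| ≤ U) ∧ (∀ s ∈ I, cell j s ≠ cell j x → u n s = 0) ∧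
      U / 2 ^ j ≤ C

/-- The product kernels have L¹ norm at most C C' and eventually live where f is, almost everywhere,
uniformly close to f(x, y). -/
lemma Concentrates.tendsto_integral {f : ℝ × ℝ → ℝ} (hf : IntegrableOn f I2) {x y : ℝ}
    (hx : x ∈ I) (hy : y ∈ I) (hcont : DyadicContinuousAt f x y) {u v : ℕ → ℝ → ℝ} {c c' : ℝ}
    (hu : Concentrates x u c) (hv : Concentrates y v c') :
    Tendsto (fun p : ℕ × ℕ => ∫ s in I2, f s * (u p.1 s.1 * v p.2 s.2)) (atTop ×ˢ atTop)
      (𝓝 (f (x, y) * (c * c'))) := by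
  obtain ⟨C, hC, hu⟩ := hu
  obtain ⟨C', hC', hv⟩ := hv
  rw [Metric.tendsto_nhds]
  intro ε hε
  -- The `+ 1` covers the case C C' = 0.
  have hδ : 0 < ε / (C * C' + 1) := by positivity
  obtain ⟨J, hJ⟩ := exists_level_of_dyadicContinuousAt hcont hδ
  filter_upwards [(hu J).prod_mk (hv J)] with p ⟨⟨h1, h2, j, hj, U, h3, h4, h5⟩,
    ⟨k1, k2, j', hj', U', k3, k4, k5⟩⟩
  have h := abs_integral_sub_le_of_support hf hx hy h1 k1 h3 k3 hj hj' h4 k4 hJ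
  rw [h2, k2] at h
  rw [Real.dist_eq]
  refine h.trans_lt ?_
  have hU' : 0 ≤ U' := (abs_nonneg _).trans (k3 0 ⟨le_rfl, one_pos⟩)
  calc ε / (C * C' + 1) * (U / 2 ^ j) * (U' / 2 ^ j') ≤ ε / (C * C' + 1) * C * C' := by
        gcongr
    _ = ε * (C * C') / (C * C' + 1) := by ring
    _ < ε := by
        rw [div_lt_iff₀ (by positivity)]
        nlinarith

lemma eventually_le_log (J : ℕ) : ∀ᶠ n : ℕ in atTop, n ≠ 0 ∧ J ≤ Nat.log 2 n := by
  filter_upwards [eventually_ge_atTop (2 ^ J)] with n hn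
  have : 0 < 2 ^ J := by positivity
  exact ⟨by omega, Nat.le_log_of_pow_le (by norm_num) hn⟩

lemma integral_dyadicKernel {x : ℝ} (hx : x ∈ I) (p : ℕ) : ∫ s in I, dyadicKernel x p s = 1 := by
  have hsub : {s | s ∈ I ∧ cell p s = cell p x} ⊆ I := fun s hs => hs.1
  have hm : MeasurableSet {s | s ∈ I ∧ cell p s = cell p x} := by
    rw [setOf_cell_eq hx]
    exact measurableSet_Ico
  rw [setIntegral_eq_of_subset_of_forall_sdiff_eq_zero measurableSet_I hsub (fun s hs => ?_),
    setIntegral_congr_fun (g := fun _ => (2 : ℝ) ^ p) hm (fun s hs => ?_), setIntegral_const,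
    setOf_cell_eq hx, Real.volume_real_Ico, ← sub_div, add_sub_cancel_left,
    max_eq_left (by positivity), smul_eq_mul]
  · field_simp
  · exact if_pos hs.2
  · exact if_neg fun h => hs.2 ⟨hs.1, h⟩

lemma concentrates_dyadicKernel {x : ℝ} (hx : x ∈ I) :
    Concentrates x (fun n => dyadicKernel x (Nat.log 2 n)) 1 := by
  refine ⟨1, zero_le_one, fun J => ?_⟩
  filter_upwards [eventually_le_log J] with n hn
  refine ⟨measurable_dyadicKernel _ _, integral_dyadicKernel hx _, Nat.log 2 n, hn.2,
    2 ^ Nat.log 2 n, fun s _ => abs_dyadicKernel_le _ _ s, fun s _ hs => if_neg hs, ?_⟩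
  rw [div_self (by positivity)]

/-- For a fixed index the support lies in an interval of length 2^{-(q-d)} and the height is O(2^q),
so the mass is O(2^d) uniformly in n. This grows with d and cannot be summed; the domination comes
from the variation of f instead. -/
lemma concentrates_kernelPiece {α : ℝ} (hα : α ∈ Set.Ioo (0 : ℝ) 1) {x : ℝ} (hx : x ∈ I)
    (k : ℕ × ℕ) : Concentrates x (fun n => kernelPiece α n x k) 0 := by
  have hκ := kernelConst_pos hα
  refine ⟨kernelConst α * 2 ^ k.2, by positivity, fun J => ?_⟩
  filter_upwards [eventually_le_log (J + (k.1 + k.2))] with n hn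
  have hk : k.1 + k.2 ≤ Nat.log 2 n := by omega
  have h := isHaarPiece_kernelPiece hα hn.1 hx hk
  refine ⟨h.measurable, h.integral_eq_zero, Nat.log 2 n - k.1 - k.2, by omega, _, h.bound,
    fun s _ hs => ?_, ?_⟩
  · rw [kernelPiece, if_pos hk, shellKernel, Set.indicator_of_notMem]
    exact fun h' => hs h'.1
  · have h1 : ((2 : ℝ) ^ k.2) ^ (α - 1) ≤ 1 :=
      Real.rpow_le_one_of_one_le_of_nonpos (one_le_pow₀ (by norm_num)) (by linarith [hα.2])
    have h2 : ((1 : ℝ) / 2) ^ k.1 ≤ 1 := pow_le_one₀ (by norm_num) (by norm_num)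
    have h3 : (2 : ℝ) ^ (Nat.log 2 n - k.1) = 2 ^ (Nat.log 2 n - k.1 - k.2) * 2 ^ k.2 := by
      rw [← pow_add]
      congr 1
      omega
    rw [pieceBound, h3, div_le_iff₀ (by positivity)]
    have h4 : 0 ≤ ((2 : ℝ) ^ k.2) ^ (α - 1) := by positivity
    calc kernelConst α * (1 / 2) ^ k.1 * (2 ^ (Nat.log 2 n - k.1 - k.2) * 2 ^ k.2) *
          ((2 : ℝ) ^ k.2) ^ (α - 1)
        ≤ kernelConst α * 1 * (2 ^ (Nat.log 2 n - k.1 - k.2) * 2 ^ k.2) * 1 := by gcongr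
      _ = _ := by ring

/-! ### Summation over the pieces -/

/-- Tannery's theorem: since the terms vanish off `F p`, the finite sums are complete series. -/
lemma tendsto_sum_zero_of_dominated {κ ι : Type*} {𝓕 : Filter κ} {T : κ → ι → ℝ}
    {F : κ → Finset ι} {b : ι → ℝ} (hb : Summable b) (hT : ∀ k, Tendsto (fun p => T p k) 𝓕 (𝓝 0))
    (h0 : ∀ p, ∀ k ∉ F p, T p k = 0) (hTb : ∀ᶠ p in 𝓕, ∀ k, |T p k| ≤ b k) :
    Tendsto (fun p => ∑ k ∈ F p, T p k) 𝓕 (𝓝 0) := by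
  have h := tendsto_tsum_of_dominated_convergence hb hT hTb
  rw [tsum_zero] at h
  refine h.congr fun p => ?_
  exact tsum_eq_sum fun k hk => h0 p k hk

/-- The decay of the contribution of the piece with index `k`. -/
noncomputable def pieceWeight (δ : ℝ) (k : ℕ × ℕ) : ℝ := (1 / 2) ^ k.1 * ((2 : ℝ) ^ (-δ)) ^ k.2

lemma pieceWeight_nonneg (δ : ℝ) (k : ℕ × ℕ) : 0 ≤ pieceWeight δ k := by
  unfold pieceWeight
  positivity

lemma summable_pieceWeight {δ : ℝ} (hδ : 0 < δ) : Summable (pieceWeight δ) := by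
  refine Summable.mul_of_nonneg (f := fun i : ℕ => ((1 : ℝ) / 2) ^ i)
    (g := fun d : ℕ => ((2 : ℝ) ^ (-δ)) ^ d) ?_ ?_ (fun i => by positivity) (fun d => by positivity)
  · exact summable_geometric_of_lt_one (by norm_num) (by norm_num)
  · refine summable_geometric_of_lt_one (by positivity) ?_
    exact Real.rpow_lt_one_of_one_lt_of_neg (by norm_num) (by linarith)

/-- The size 2^{-d(1-β)} of a piece against the growth 2^{d(1-α-β)} of the variation sums leaves
geometric decay. This is where the exponent of λ_n enters. -/
lemma two_pow_rpow_mul_rpow (α β : ℝ) (d : ℕ) :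
    ((2 : ℝ) ^ d) ^ (β - 1) * ((2 : ℝ) ^ d) ^ (1 - (α + β)) = ((2 : ℝ) ^ (-α)) ^ d := by
  rw [← Real.rpow_add (by positivity), Real.rpow_pow_comm (by norm_num)]
  congr 1
  ring

/-! ### Bounds for the pieces, uniform in the orders of the means -/

section Bounds

variable {α β : ℝ}

lemma rpow_seq_monotone (hαβ : α + β < 1) :
    Monotone fun n : ℕ => (n : ℝ) ^ (1 - (α + β)) := fun a b hab =>
  Real.rpow_le_rpow (by positivity) (by exact_mod_cast hab) (by linarith)

lemma rpow_seq_nonneg : 0 ≤ (fun n : ℕ => (n : ℝ) ^ (1 - (α + β))) 0 := by positivity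

lemma rpow_seq_pos (k : ℕ) : 0 < (fun n : ℕ => (n : ℝ) ^ (1 - (α + β))) (k + 1) := by
  have : (0 : ℝ) < ((k + 1 : ℕ) : ℝ) := by positivity
  exact Real.rpow_pos_of_pos this _

lemma abs_integral_dyadic_piece_le (hβ : β ∈ Set.Ioo (0 : ℝ) 1) (hαβ : α + β < 1)
    {f : ℝ × ℝ → ℝ} {V : ℝ} (hV0 : 0 ≤ V)
    (hV : V2 (fun n : ℕ => (n : ℝ) ^ (1 - (α + β))) f ≤ ENNReal.ofReal V)
    (hf : IntegrableOn f I2) {x y : ℝ} (hx : x ∈ I) (hy : y ∈ I) (p : ℕ) {m : ℕ} (hm : m ≠ 0)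
    (k : ℕ × ℕ) :
    |∫ s in I2, f s * (dyadicKernel x p s.1 * kernelPiece β m y k s.2)| ≤
      kernelConst β * V * pieceWeight α k := by
  have hκ := kernelConst_pos hβ
  by_cases hk : k.1 + k.2 ≤ Nat.log 2 m
  · refine (abs_integral_dyadic_haar_le (rpow_seq_monotone hαβ) rpow_seq_nonneg rpow_seq_pos hV0 hV
      hf hx (isHaarPiece_kernelPiece hβ hm hy hk)).trans ?_
    set q := Nat.log 2 m - k.1
    have hc : ((shellCells y q k.2).card : ℝ) ≤ 2 ^ k.2 := by
      exact_mod_cast card_shellCells_le y q k.2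
    have hc' : ((shellCells y q k.2).card : ℝ) ^ (1 - (α + β)) ≤
        ((2 : ℝ) ^ k.2) ^ (1 - (α + β)) :=
      Real.rpow_le_rpow (by positivity) hc (by linarith)
    have e := two_pow_rpow_mul_rpow α β k.2
    rw [div_le_iff₀ (by positivity)]
    have hw := pieceWeight_nonneg α k
    calc pieceBound β (Nat.log 2 m) k * (((shellCells y q k.2).card : ℝ) ^ (1 - (α + β)) * V)
        ≤ pieceBound β (Nat.log 2 m) k * (((2 : ℝ) ^ k.2) ^ (1 - (α + β)) * V) := by
          have : 0 ≤ pieceBound β (Nat.log 2 m) k := by unfold pieceBound; positivity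
          gcongr
      _ = kernelConst β * V * pieceWeight α k * 2 ^ q := by
          rw [pieceBound, pieceWeight, ← e]
          ring
      _ ≤ kernelConst β * V * pieceWeight α k * (2 ^ (q + 1) : ℕ) := by
          push_cast
          gcongr
          · norm_num
          · omega
  · have h0 : ∀ s, kernelPiece β m y k s = 0 := fun s => if_neg hk
    simp only [h0, mul_zero, integral_zero, abs_zero]
    exact mul_nonneg (by positivity) (pieceWeight_nonneg α k)

/-- The rates cross: the factor 2^{d(α-1)} of a piece in the first variable cancels the α in the
exponent 1 - (α + β) and leaves 2^{-βd}; in the second variable 2^{-αd'} is left. -/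
lemma abs_integral_piece_piece_le (hα : α ∈ Set.Ioo (0 : ℝ) 1) (hβ : β ∈ Set.Ioo (0 : ℝ) 1)
    (hαβ : α + β < 1) {f : ℝ × ℝ → ℝ} {V : ℝ} (hV0 : 0 ≤ V)
    (hV : VStar (fun n : ℕ => (n : ℝ) ^ (1 - (α + β))) f ≤ ENNReal.ofReal V)
    (hf : IntegrableOn f I2) {x y : ℝ} (hx : x ∈ I) (hy : y ∈ I) {n m : ℕ} (hn : n ≠ 0)
    (hm : m ≠ 0) (k l : ℕ × ℕ) :
    |∫ s in I2, f s * (kernelPiece α n x k s.1 * kernelPiece β m y l s.2)| ≤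
      kernelConst α * kernelConst β * V * (pieceWeight β k * pieceWeight α l) := by
  have hκ := kernelConst_pos hα
  have hκ' := kernelConst_pos hβ
  have hw := pieceWeight_nonneg β k
  have hw' := pieceWeight_nonneg α l
  by_cases hk : k.1 + k.2 ≤ Nat.log 2 n
  · by_cases hl : l.1 + l.2 ≤ Nat.log 2 m
    · refine (abs_integral_haar_haar_le (rpow_seq_monotone hαβ) rpow_seq_nonneg rpow_seq_pos hV0 hV
        hf (isHaarPiece_kernelPiece hα hn hx hk) (isHaarPiece_kernelPiece hβ hm hy hl)).trans ?_
      set q := Nat.log 2 n - k.1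
      set q' := Nat.log 2 m - l.1
      have hc : (((shellCells x q k.2).card * (shellCells y q' l.2).card : ℕ) : ℝ) ≤
          2 ^ k.2 * 2 ^ l.2 := by
        exact_mod_cast Nat.mul_le_mul (card_shellCells_le x q k.2) (card_shellCells_le y q' l.2)
      have hc' : (((shellCells x q k.2).card * (shellCells y q' l.2).card : ℕ) : ℝ) ^
          (1 - (α + β)) ≤ ((2 : ℝ) ^ k.2) ^ (1 - (α + β)) * ((2 : ℝ) ^ l.2) ^ (1 - (α + β)) := by
        rw [← Real.mul_rpow (by positivity) (by positivity)]
        exact Real.rpow_le_rpow (by positivity) hc (by linarith)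
      have e := two_pow_rpow_mul_rpow α β l.2
      have e' := two_pow_rpow_mul_rpow β α k.2
      rw [add_comm β α] at e'
      rw [div_le_iff₀ (by positivity)]
      have hb : 0 ≤ pieceBound α (Nat.log 2 n) k := by unfold pieceBound; positivity
      have hb' : 0 ≤ pieceBound β (Nat.log 2 m) l := by unfold pieceBound; positivity
      refine (mul_le_mul_of_nonneg_left (mul_le_mul_of_nonneg_right hc' hV0)
        (mul_nonneg hb hb')).trans ?_
      calc pieceBound α (Nat.log 2 n) k * pieceBound β (Nat.log 2 m) l *
            (((2 : ℝ) ^ k.2) ^ (1 - (α + β)) * ((2 : ℝ) ^ l.2) ^ (1 - (α + β)) * V)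
          = kernelConst α * kernelConst β * V * (pieceWeight β k * pieceWeight α l) *
              (2 ^ q * 2 ^ q') := by
            rw [pieceBound, pieceBound, pieceWeight, pieceWeight, ← e, ← e']
            ring
        _ ≤ kernelConst α * kernelConst β * V * (pieceWeight β k * pieceWeight α l) *
              ((2 ^ (q + 1) : ℕ) * (2 ^ (q' + 1) : ℕ)) := by
            push_cast
            gcongr
            · norm_num
            · omega
            · norm_num
            · omega
    · have h0 : ∀ s, kernelPiece β m y l s = 0 := fun s => if_neg hl
      simp only [h0, mul_zero, integral_zero, abs_zero]
      positivity
  · have h0 : ∀ s, kernelPiece α n x k s = 0 := fun s => if_neg hk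
    simp only [h0, zero_mul, mul_zero, integral_zero, abs_zero]
    positivity

end Bounds

/-! ### Boundedness and integrability of functions in the class -/

lemma exists_variation_bound {L : ℕ → ℝ} {f : ℝ × ℝ → ℝ} (hf : f ∈ StarBV L) :
    ∃ V, 0 ≤ V ∧ V1 L f ≤ ENNReal.ofReal V ∧ V2 L f ≤ ENNReal.ofReal V ∧
      VStar L f ≤ ENNReal.ofReal V := by
  refine ⟨(V1 L f + V2 L f + VStar L f).toReal, ENNReal.toReal_nonneg, ?_⟩
  rw [ENNReal.ofReal_toReal hf.2.ne]
  exact ⟨le_add_right (le_add_right le_rfl), le_add_right (le_add_left le_rfl),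
    le_add_left le_rfl⟩

/-- Any point is reached from the origin along a horizontal and a vertical segment, and one interval
of either variation bounds the change of f on it. So f is bounded. -/
lemma integrableOn_of_mem_StarBV {L : ℕ → ℝ} (hL : Monotone L) (hL0 : 0 ≤ L 0)
    (hL1 : ∀ k, 0 < L (k + 1)) {f : ℝ × ℝ → ℝ} (hf : f ∈ StarBV L) : IntegrableOn f I2 := by
  obtain ⟨V, hV0, h1, h2, -⟩ := exists_variation_bound hf
  have h0 : (0 : ℝ) ∈ I := ⟨le_rfl, one_pos⟩
  refine Integrable.mono' (integrableOn_const_I2 (|f (0, 0)| + L 1 * V + L 1 * V))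
    hf.1.aestronglyMeasurable (ae_restrict_of_forall_mem measurableSet_I2 fun p hp => ?_)
  · have k1 := abs_sub_le_of_V2_le hL hL0 hL1 hV0 h2 hp.1 hp.2 h0
    have k2 := abs_sub_le_of_V2_le (f := f ∘ Prod.swap) hL hL0 hL1 hV0 h1 h0 hp.1 h0
    simp only [Function.comp, Prod.swap_prod_mk] at k2
    rw [Real.norm_eq_abs]
    have e : f p = (f (p.1, p.2) - f (p.1, 0)) + (f (p.1, 0) - f (0, 0)) + f (0, 0) := by
      ring
    rw [e]
    have := abs_add_three (f (p.1, p.2) - f (p.1, 0)) (f (p.1, 0) - f (0, 0)) (f (0, 0))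
    linarith

end DoubleWalsh

/-! ### The convergence theorem -/

theorem mainTheorem7 (α β : ℝ) (hα : α ∈ Set.Ioo (0 : ℝ) 1) (hβ : β ∈ Set.Ioo (0 : ℝ) 1)
    (hαβ : α + β < 1) (f : ℝ × ℝ → ℝ)
    (hf : f ∈ DoubleWalsh.StarBV (fun n : ℕ => (n : ℝ) ^ (1 - (α + β))))
    (x y : ℝ) (hx : x ∈ DoubleWalsh.I) (hy : y ∈ DoubleWalsh.I)
    (hcont : DoubleWalsh.DyadicContinuousAt f x y) :
    Tendsto (fun p : ℕ × ℕ => DoubleWalsh.cesaroMean (-α) (-β) f p.1 p.2 x y)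
      (atTop ×ˢ atTop) (𝓝 (f (x, y))) := by
  open DoubleWalsh in
  obtain ⟨V, hV0, hV1, hV2, hV⟩ := exists_variation_bound hf
  have hint : IntegrableOn f I2 :=
    integrableOn_of_mem_StarBV (rpow_seq_monotone hαβ) rpow_seq_nonneg rpow_seq_pos hf
  have hint' : IntegrableOn (f ∘ Prod.swap) I2 := hint.swap
  have hpos : ∀ᶠ p : ℕ × ℕ in atTop ×ˢ atTop, p.1 ≠ 0 ∧ p.2 ≠ 0 :=
    (eventually_ne_atTop 0).prod_mk (eventually_ne_atTop 0)
  have hκ := kernelConst_pos hα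
  have hκ' := kernelConst_pos hβ
  have t1 := (concentrates_dyadicKernel hx).tendsto_integral hint hx hy hcont
    (concentrates_dyadicKernel hy)
  have t2 : Tendsto (fun p : ℕ × ℕ => ∑ k ∈ pieceIndex p.2, ∫ s in I2,
      f s * (dyadicKernel x (Nat.log 2 p.1) s.1 * kernelPiece β p.2 y k s.2))
      (atTop ×ˢ atTop) (𝓝 0) := by
    refine tendsto_sum_zero_of_dominated ((summable_pieceWeight hα.1).mul_left (kernelConst β * V))
      (fun k => ?_) (fun p k hk => ?_) ?_
    · simpa using (concentrates_dyadicKernel hx).tendsto_integral hint hx hy hcont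
        (concentrates_kernelPiece hβ hy k)
    · simp [kernelPiece_eq_zero_of_notMem β p.2 y hk]
    · filter_upwards [hpos] with p hp k
      exact abs_integral_dyadic_piece_le hβ hαβ hV0 hV2 hint hx hy _ hp.2 k
  have t3 : Tendsto (fun p : ℕ × ℕ => ∑ k ∈ pieceIndex p.1, ∫ s in I2,
      f s * (kernelPiece α p.1 x k s.1 * dyadicKernel y (Nat.log 2 p.2) s.2))
      (atTop ×ˢ atTop) (𝓝 0) := by
    refine tendsto_sum_zero_of_dominated ((summable_pieceWeight hβ.1).mul_left (kernelConst α * V))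
      (fun k => ?_) (fun p k hk => ?_) ?_
    · simpa using (concentrates_kernelPiece hα hx k).tendsto_integral hint hx hy hcont
        (concentrates_dyadicKernel hy)
    · simp [kernelPiece_eq_zero_of_notMem α p.1 x hk]
    · filter_upwards [hpos] with p hp k
      -- Exchanging the variables exchanges α with β and V₁ with V₂, which reduces this case to the
      -- preceding one.
      rw [integral_mul_swap]
      rw [V1_eq_V2_swap, add_comm α β] at hV1
      exact abs_integral_dyadic_piece_le hα (by linarith) hV0 hV1 hint' hy hx _ hp.1 k
  have t4 : Tendsto (fun p : ℕ × ℕ => ∑ k ∈ pieceIndex p.1, ∑ l ∈ pieceIndex p.2, ∫ s in I2,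
      f s * (kernelPiece α p.1 x k s.1 * kernelPiece β p.2 y l s.2))
      (atTop ×ˢ atTop) (𝓝 0) := by
    -- The double sum is regarded as one series over pairs of indices, so that a single dominated
    -- passage to the limit suffices.
    simp_rw [← Finset.sum_product']
    refine tendsto_sum_zero_of_dominated (((summable_pieceWeight hβ.1).mul_of_nonneg
      (summable_pieceWeight hα.1) (pieceWeight_nonneg β) (pieceWeight_nonneg α)).mul_left
      (kernelConst α * kernelConst β * V)) (fun k => ?_) (fun p k hk => ?_) ?_
    · simpa using (concentrates_kernelPiece hα hx k.1).tendsto_integral hint hx hy hcont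
        (concentrates_kernelPiece hβ hy k.2)
    · by_cases h : k.1 ∈ pieceIndex p.1
      · simp [kernelPiece_eq_zero_of_notMem β p.2 y
          (fun h' => hk (Finset.mem_product.2 ⟨h, h'⟩))]
      · simp [kernelPiece_eq_zero_of_notMem α p.1 x h]
    · filter_upwards [hpos] with p hp k
      exact abs_integral_piece_piece_le hα hβ hαβ hV0 hV hint hx hy hp.1 hp.2 k.1 k.2
  -- Only the product of the two Dirichlet kernels contributes to the limit.
  have t := (t1.add t2).add (t3.add t4)
  simp only [mul_one, add_zero] at t
  refine t.congr' ?_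
  filter_upwards [hpos] with p hp
  rw [cesaroMean_eq_integral α β hint, integral_cesaroKernel_eq hα hβ hint hp.1 hp.2 hx hy]
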